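/- Let $k$ be a field of characteristic zero and let $Y=\operatorname{Spec} A$ be a smooth irreducible (hence integral) affine variety over $k$, where a variety over $k$ means a scheme of finite type over $k$. Let $x_1,\dots,x_r\in A$ ($r\ge 1$) be regular parameters on $Y$: the closed subscheme $V(x_1,\dots,x_r)$ is nonempty, and at each of its points $p$ the elements $x_1,\dots,x_r$ extend to a regular system of parameters of $\mathcal{O}_{Y,p}$. Let $w_1,\dots,w_r$ be positive integers. Let $\mathbf{ZR}(Y)$ be the set of valuation rings $R_v$ of the function field $K$ of $Y$ that contain $k$ and have a center on $Y$ (that is, $A\subseteq R_v$), with valuation $v\colon K^*\to\Gamma_v=K^*/R_v^*$, written additively, and $v(0)=\infty$. The center $\gamma=(x_1^{1/w_1},\dots,x_r^{1/w_r})$ is given by $$\gamma_v=\min_i \tfrac{1}{w_i}\,v(x_i)\in\Gamma_v\otimes_{\mathbb Z}\mathbb{Q}\qquad (v\in\mathbf{ZR}(Y)).$$ For $m\ge 0$ put $I_{m\gamma}=\{f\in A : v(f)\ge m\gamma_v \text{ for all } v\in \mathbf{ZR}(Y)\}$, let $A_\gamma=\bigoplus_{m\ge 0}I_{m\gamma}T^m\subseteq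 A[T]$ be the associated Rees algebra, and let $y_i=x_iT^{w_i}\in A_\gamma$. The $x_i$-chart of the weighted blow-up of $Y$ along $\gamma$ is $$W_i=\operatorname{Spec} A_\gamma[y_i^{-1}]/(y_i-1).$$ Then the $x_1$-chart $W_1$, and likewise each chart $W_i$ for $1\le i\le r$, is an irreducible smooth variety over $k$ of the same dimension as $Y$. -/

import Mathlib

open AlgebraicGeometry CategoryTheory Polynomial

universe u

namespace WeightedBlowup

/-! ### Varieties -/

/-- A variety over `k` is a scheme of finite type over `k`; it is smooth if its structure
morphism is smooth. -/
structure IsSmoothVariety {k : Type u} [Field k] {X : Scheme.{u}}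
    (f : X ⟶ Spec (CommRingCat.of k)) : Prop where
  locallyOfFiniteType : LocallyOfFiniteType f
  quasiCompact : QuasiCompact f
  smooth : Smooth f

/-- The structure morphism `Spec B ⟶ Spec k` of a `k`-algebra `B`. -/
noncomputable def structureMap (k B : Type u) [Field k] [CommRing B] [Algebra k B] :
    Spec (CommRingCat.of B) ⟶ Spec (CommRingCat.of k) :=
  Spec.map (CommRingCat.ofHom (algebraMap k B))

/-! ### Regular parameters -/

/-- `z₁, …, zₙ` is a regular system of parameters of the local ring `R`: it generates the
maximal ideal and `n = dim R`. -/
def IsRegularSystemOfParameters {R : Type*} [CommRing R] [IsLocalRing R] {n : ℕ}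
    (z : Fin n → R) : Prop :=
  Ideal.span (Set.range z) = IsLocalRing.maximalIdeal R ∧ (n : WithBot ℕ∞) = ringKrullDim R

/-- `x₁, …, x_r` (`r ≥ 1`) are regular parameters on `Spec A`: `V(x₁, …, x_r)` is nonempty and at
each of its points `p` they extend to a regular system of parameters of the local ring at `p`. -/
structure IsRegularParameters {A : Type*} [CommRing A] {r : ℕ} (x : Fin r → A) : Prop where
  pos : 0 < r
  nonempty : (PrimeSpectrum.zeroLocus (Set.range x)).Nonempty
  extend : ∀ p ∈ PrimeSpectrum.zeroLocus (Set.range x),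
    ∃ (s : ℕ) (z : Fin s → Localization.AtPrime p.asIdeal),
      IsRegularSystemOfParameters
        (Fin.append (fun i => algebraMap A (Localization.AtPrime p.asIdeal) (x i)) z)

/-! ### The Zariski-Riemann space and its value groups -/

section Valuations

variable {K : Type*} [Field K]

/-- The value group `Γ_v = K^* / R_v^*`, written additively and ordered so that the classes of the
nonzero elements of `R_v` are the nonnegative ones (the value group of Mathlib is the
multiplicative one, with the opposite order, and with a zero). -/
def AddValueGroup (R : ValuationSubring K) : Type _ := (Additive (R.ValueGroup)ˣ)ᵒᵈ

noncomputable instance (R : ValuationSubring K) : AddCommGroup (AddValueGroup R) :=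
  inferInstanceAs (AddCommGroup (Additive (R.ValueGroup)ˣ)ᵒᵈ)

noncomputable instance (R : ValuationSubring K) : LinearOrder (AddValueGroup R) :=
  inferInstanceAs (LinearOrder (Additive (R.ValueGroup)ˣ)ᵒᵈ)

instance (R : ValuationSubring K) : IsOrderedAddMonoid (AddValueGroup R) :=
  inferInstanceAs (IsOrderedAddMonoid (Additive (R.ValueGroup)ˣ)ᵒᵈ)

/-- The class of a nonzero `f` in `Γ_v`. -/
noncomputable def valueClass (R : ValuationSubring K) (f : K) (hf : f ≠ 0) : AddValueGroup R :=
  OrderDual.toDual (Additive.ofMul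
    (Units.mk0 (R.valuation f) ((map_ne_zero R.valuation).2 hf)))

/-- The ordered group `Γ_v ⊗ ℚ`. -/
abbrev RatValueGroup (R : ValuationSubring K) : Type _ :=
  DivisibleHull (AddValueGroup R)

lemma valueClass_le {R : ValuationSubring K} {f g : K} (hf : f ≠ 0) (hg : g ≠ 0) :
    valueClass R f hf ≤ valueClass R g hg ↔ R.valuation g ≤ R.valuation f := Iff.rfl

lemma valueClass_mul {R : ValuationSubring K} {f g : K} (hf : f ≠ 0) (hg : g ≠ 0) :
    valueClass R (f * g) (mul_ne_zero hf hg) = valueClass R f hf + valueClass R g hg :=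
  congrArg (fun u => OrderDual.toDual (Additive.ofMul u))
    (Units.ext (map_mul R.valuation f g))

lemma valueClass_one (R : ValuationSubring K) : valueClass R 1 one_ne_zero = 0 :=
  congrArg (fun u => OrderDual.toDual (Additive.ofMul u)) (Units.ext (map_one R.valuation))

/-- The additive valuation `v : K → (Γ_v ⊗ ℚ) ∪ {∞}` of a valuation ring of `K`. -/
noncomputable def val (R : ValuationSubring K) (f : K) : WithTop (RatValueGroup R) :=
  open Classical in
  if hf : f = 0 then ⊤ else
    ((DivisibleHull.mk (valueClass R f hf) 1 : RatValueGroup R) : WithTop (RatValueGroup R))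

lemma val_mk {R : ValuationSubring K} {f : K} (hf : f ≠ 0) :
    val R f = ((DivisibleHull.mk (valueClass R f hf) 1 : RatValueGroup R) :
      WithTop (RatValueGroup R)) := dif_neg hf

lemma val_zero (R : ValuationSubring K) : val R 0 = ⊤ := dif_pos rfl

lemma val_le_val {R : ValuationSubring K} {f g : K} :
    val R f ≤ val R g ↔ R.valuation g ≤ R.valuation f := by
  by_cases hf : f = 0
  · subst hf
    by_cases hg : g = 0
    · subst hg; simp
    · simp [val_zero, val_mk hg, hg]
  · by_cases hg : g = 0
    · subst hg; simp [val_zero]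
    · rw [val_mk hf, val_mk hg, WithTop.coe_le_coe, DivisibleHull.mk_le_mk, PNat.one_coe,
        one_smul, one_smul, valueClass_le]

lemma val_mul (R : ValuationSubring K) (f g : K) : val R (f * g) = val R f + val R g := by
  by_cases hf : f = 0
  · subst hf; simp [val_zero]
  by_cases hg : g = 0
  · subst hg; simp [val_zero]
  rw [val_mk hf, val_mk hg, val_mk (mul_ne_zero hf hg), ← WithTop.coe_add,
    DivisibleHull.mk_add_mk_left, valueClass_mul]

lemma val_one (R : ValuationSubring K) : val R 1 = 0 := by
  rw [val_mk one_ne_zero, valueClass_one, DivisibleHull.mk_zero, WithTop.coe_zero]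

lemma val_nonneg {R : ValuationSubring K} {f : K} (hf : f ∈ R) : 0 ≤ val R f := by
  rw [← val_one R, val_le_val, map_one]
  exact (R.valuation_le_one_iff f).2 hf

lemma le_val_add {R : ValuationSubring K} {f g : K} {c : WithTop (RatValueGroup R)}
    (hf : c ≤ val R f) (hg : c ≤ val R g) : c ≤ val R (f + g) := by
  rcases le_total (R.valuation f) (R.valuation g) with h | h
  · exact hg.trans (val_le_val.2 ((R.valuation.map_add f g).trans (max_le h le_rfl)))
  · exact hf.trans (val_le_val.2 ((R.valuation.map_add f g).trans (max_le le_rfl h)))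

/-- Multiplication by a positive rational number `a` on `(Γ_v ⊗ ℚ) ∪ {∞}`. -/
noncomputable def ratMul {R : ValuationSubring K} (a : ℚ) (c : WithTop (RatValueGroup R)) :
    WithTop (RatValueGroup R) :=
  c.map (fun g => a • g)

lemma nsmul_ratMul {R : ValuationSubring K} (w : ℕ+) (c : WithTop (RatValueGroup R)) :
    (w : ℕ) • ratMul (1 / (w : ℚ)) c = c := by
  have hw : ((w : ℕ) : ℚ) ≠ 0 := by exact_mod_cast w.pos.ne'
  induction c using WithTop.recTopCoe with
  | top =>
    obtain ⟨n, hn⟩ := Nat.exists_eq_succ_of_ne_zero w.pos.ne'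
    rw [hn, succ_nsmul]
    simp [ratMul]
  | coe g =>
    rw [ratMul, WithTop.map_coe, ← WithTop.coe_nsmul, ← Nat.cast_smul_eq_nsmul ℚ, smul_smul,
      mul_one_div_cancel hw, one_smul]

end Valuations

section Center

variable {A : Type*} [CommRing A] [IsDomain A]

/-- The Zariski-Riemann space of `Y = Spec A`: the valuation rings of the function field of `Y`
which have a center on `Y`. For affine `Y` this means that they contain `A` (so, for a
`k`-algebra `A`, they also contain `k`). -/
def ZariskiRiemann (A : Type*) [CommRing A] [IsDomain A] : Type _ :=
  {R : ValuationSubring (FractionRing A) // ∀ a : A, algebraMap A (FractionRing A) a ∈ R}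

/-- `v f` for `f ∈ A` and `v ∈ ZR(Spec A)`. -/
noncomputable def ZariskiRiemann.eval (v : ZariskiRiemann A) (f : A) :
    WithTop (RatValueGroup v.1) :=
  val v.1 (algebraMap A (FractionRing A) f)

/-- The valuative `ℚ`-ideal `γ = (x₁^{1/w₁}, …, x_r^{1/w_r})`:
`γ_v = min_i (1 / w_i) · v(x_i)`. -/
noncomputable def center {r : ℕ} (x : Fin r → A) (w : Fin r → ℕ+) (v : ZariskiRiemann A) :
    WithTop (RatValueGroup v.1) :=
  Finset.univ.inf fun i => ratMul (1 / ((w i : ℕ) : ℚ)) (v.eval (x i))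

/-- `f ∈ I_{mγ}`: one has `v f ≥ m γ_v` for all `v ∈ ZR(Spec A)`. -/
def MemIdeal {r : ℕ} (x : Fin r → A) (w : Fin r → ℕ+) (m : ℕ) (f : A) : Prop :=
  ∀ v : ZariskiRiemann A, m • center x w v ≤ v.eval f

/-- The Rees algebra `A_γ = ⨁_{m ≥ 0} I_{mγ} T^m ⊆ A[T]` of `γ = (x₁^{1/w₁}, …, x_r^{1/w_r})`. -/
noncomputable def reesAlg {r : ℕ} (x : Fin r → A) (w : Fin r → ℕ+) : Subalgebra A A[X] where
  carrier := {F | ∀ m : ℕ, MemIdeal x w m (F.coeff m)}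
  add_mem' {F G} hF hG m v := by
    rw [coeff_add, ZariskiRiemann.eval, map_add]
    exact le_val_add (hF m v) (hG m v)
  mul_mem' {F G} hF hG m v := by
    rw [coeff_mul]
    refine Finset.sum_induction _ (fun f => m • center x w v ≤ v.eval f) ?_ ?_ ?_
    · intro f g hf hg
      rw [ZariskiRiemann.eval, map_add]
      exact le_val_add hf hg
    · simp [ZariskiRiemann.eval, val_zero]
    · rintro ⟨a, b⟩ hab
      rw [Finset.HasAntidiagonal.mem_antidiagonal] at hab
      change a + b = m at hab
      rw [← hab, add_nsmul, ZariskiRiemann.eval, map_mul, val_mul]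
      exact add_le_add (hF a v) (hG b v)
  algebraMap_mem' a m v := by
    rw [Polynomial.algebraMap_apply, coeff_C, Algebra.algebraMap_self_apply]
    split_ifs with h
    · subst h
      rw [zero_nsmul]
      exact val_nonneg (v.2 _)
    · simp [ZariskiRiemann.eval, val_zero]

/-- The element `y_i = x_i T^{w_i}` of `A_γ`. -/
noncomputable def y {r : ℕ} (x : Fin r → A) (w : Fin r → ℕ+) (i : Fin r) : reesAlg x w :=
  ⟨C (x i) * X ^ (w i : ℕ), by
    intro m v
    rw [coeff_C_mul_X_pow]
    split_ifs with h
    · subst h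
      calc (w i : ℕ) • center x w v
          ≤ (w i : ℕ) • ratMul (1 / ((w i : ℕ) : ℚ)) (v.eval (x i)) :=
            nsmul_le_nsmul_right (Finset.inf_le (Finset.mem_univ i)) _
        _ = v.eval (x i) := nsmul_ratMul _ _
    · simp [ZariskiRiemann.eval, val_zero]⟩

/-- The coordinate ring `A_γ[y_i⁻¹] / (y_i - 1)` of the `x_i`-chart. -/
abbrev ChartRing {r : ℕ} (x : Fin r → A) (w : Fin r → ℕ+) (i : Fin r) : Type _ :=
  Localization.Away (y x w i) ⧸
    Ideal.span {algebraMap (reesAlg x w) (Localization.Away (y x w i)) (y x w i) - 1}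

end Center

/-- The `x_i`-chart `W_i = Spec A_γ[y_i⁻¹] / (y_i - 1)` of the weighted blow-up of `Spec A` along
`(x₁^{1/w₁}, …, x_r^{1/w_r})`. -/
noncomputable def chart {A : Type u} [CommRing A] [IsDomain A] {r : ℕ} (x : Fin r → A)
    (w : Fin r → ℕ+) (i : Fin r) : Scheme.{u} :=
  Spec (CommRingCat.of (ChartRing x w i))

/-- The structure morphism `W_i ⟶ Spec k`, for a `k`-algebra `A`. -/
noncomputable def chartMap (k : Type u) {A : Type u} [Field k] [CommRing A] [IsDomain A]
    [Algebra k A] {r : ℕ} (x : Fin r → A) (w : Fin r → ℕ+) (i : Fin r) :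
    chart x w i ⟶ Spec (CommRingCat.of k) :=
  structureMap k (ChartRing x w i)

end WeightedBlowup

open scoped TensorProduct

namespace WeightedBlowup

/-! ### Dimension of finitely generated domains -/

/-! Through `x`, `A` is an algebra over `k[x_1, …, x_r]`. The chart of the weighted blow-up of
affine space has ring `k[u, x'_j]` with `x_i = u^{w_i}` and `x_j = x'_j u^{w_j}` for `j ≠ i`; let `R
= A ⊗ k[u, x'_j]` be its base change (`CoordRing`). The chart ring turns out to be `R`, and `R` is
smooth.

Smoothness (`CoordRing.smooth`). Where `u = 0`, all `x_j` vanish; there the regular parameters make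
`A` smooth over `k[x]`, so `R` is smooth over `k[u, x'_j]`. Where `u` is invertible, `R` is `A[u,
u⁻¹]/(u^{w_i} - x_i)`, étale over `A` because `w_i` is invertible in `k`.

Identification. Let `K = Frac A` and `L = K(θ)` with `θ^{w_i} = x_i`. The polynomial `X^{w_i} - x_i`
is irreducible over `K` by Eisenstein, since `x_i ∉ p²` for `p ∈ V(x)`. Hence `R` (via `u ↦ θ`) and
the chart ring (via `T ↦ θ⁻¹`) both embed in `L` (`CoordRing.lift_injective`,
`injective_of_comp_eq_aeval_inv`). The image of `R` lies in that of the chart ring because `u` and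
`x'_j` come from `x_i T^{w_i - 1}` and `x_j T^{w_j}`. Conversely, for `f ∈ I_{mγ}` the element
`f/θ^m` lies in every valuation ring of `L` containing `R`, so it is integral over `R`; it also lies
in `Frac R`, and `R` is normal, being smooth (`div_pow_mem_range`).

Dimension. `L` is algebraic over `A` and over the chart ring, so these finitely generated domains
have the same transcendence degree. -/

lemma ringKrullDim_eq_of_isIntegral {R S : Type*} [CommRing R] [CommRing S] [Algebra R S]
    [Algebra.IsIntegral R S] (hinj : Function.Injective (algebraMap R S)) :
    ringKrullDim S = ringKrullDim R := by
  apply le_antisymm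
  · exact Order.krullDim_le_of_strictMono (PrimeSpectrum.comap (algebraMap R S))
      fun I J h => Ideal.IsIntegral.comap_lt_comap h
  · refine iSup_le fun l => ?_
    have := Algebra.HasGoingUp.of_isIntegral (R := R) (S := S)
    obtain ⟨Q, -, hQ, hQ'⟩ := Ideal.exists_ideal_over_prime_of_isIntegral l.head.asIdeal (⊥ : Ideal S)
      (by
        intro a ha
        rw [Ideal.mem_comap, Ideal.mem_bot] at ha
        rw [(map_eq_zero_iff _ hinj).1 ha]
        exact zero_mem _)
    have : Q.LiesOver l.head.asIdeal := ⟨hQ'.symm⟩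
    obtain ⟨L, hL, -⟩ := Ideal.exists_ltSeries_of_hasGoingUp l Q
    rw [← hL]
    exact le_iSup (fun l : LTSeries (PrimeSpectrum S) => (l.length : WithBot ℕ∞)) L

/-- By Noether normalization, both invariants are the number of variables of a polynomial ring over
which `A` is finite. -/
lemma exists_ringKrullDim_eq_and_trdeg_eq (k A : Type u) [Field k] [CommRing A] [IsDomain A]
    [Algebra k A] [Algebra.FiniteType k A] :
    ∃ n : ℕ, ringKrullDim A = n ∧ Algebra.trdeg k A = n := by
  obtain ⟨s, g, hg, hfin⟩ := exists_finite_inj_algHom_of_fg k A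
  let := g.toRingHom.toAlgebra
  have : IsScalarTower k (MvPolynomial (Fin s) k) A := .of_algebraMap_eq' g.comp_algebraMap.symm
  have : Algebra.IsIntegral (MvPolynomial (Fin s) k) A := ⟨hfin.to_isIntegral⟩
  have hinj : Function.Injective (algebraMap (MvPolynomial (Fin s) k) A) := hg
  have : FaithfulSMul (MvPolynomial (Fin s) k) A := (faithfulSMul_iff_algebraMap_injective _ _).2 hinj
  refine ⟨s, ?_, ?_⟩
  · rw [ringKrullDim_eq_of_isIntegral hinj, MvPolynomial.ringKrullDim_of_isNoetherianRing]
    simp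
  · rw [← trdeg_add_eq k (MvPolynomial (Fin s) k) (A := A), MvPolynomial.trdeg_of_isDomain,
      trdeg_eq_zero]
    simp

lemma ringKrullDim_eq_of_isAlgebraic {k A B L : Type u} [Field k] [CommRing A] [IsDomain A]
    [CommRing B] [IsDomain B] [Field L] [Algebra k A] [Algebra k B] [Algebra k L] [Algebra A L]
    [Algebra B L] [IsScalarTower k A L] [IsScalarTower k B L] [FaithfulSMul A L] [FaithfulSMul B L]
    [Algebra.FiniteType k A] [Algebra.FiniteType k B] [Algebra.IsAlgebraic A L]
    [Algebra.IsAlgebraic B L] : ringKrullDim B = ringKrullDim A := by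
  obtain ⟨m, hm, hm'⟩ := exists_ringKrullDim_eq_and_trdeg_eq k A
  obtain ⟨n, hn, hn'⟩ := exists_ringKrullDim_eq_and_trdeg_eq k B
  have : FaithfulSMul k A := inferInstance
  have h1 := trdeg_add_eq k A (A := L)
  have h2 := trdeg_add_eq k B (A := L)
  rw [trdeg_eq_zero (R := A), add_zero] at h1
  rw [trdeg_eq_zero (R := B), add_zero] at h2
  rw [hm, hn]
  have : (m : Cardinal.{u}) = n := by rw [← hm', ← hn', h1, h2]
  rw [Nat.cast_inj.1 this]

/-! ### Normality of smooth algebras -/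

/-- Membership in the image of `A` can be checked locally on `Spec A`. -/
lemma mem_range_of_forall_prime {A L : Type*} [CommRing A] [CommRing L] [Algebra A L] (z : L)
    (h : ∀ p : Ideal A, p.IsPrime → ∃ s : A, s ∉ p ∧ s • z ∈ LinearMap.range (Algebra.linearMap A L)) :
    z ∈ LinearMap.range (Algebra.linearMap A L) := by
  let I : Ideal A := (LinearMap.range (Algebra.linearMap A L)).comap (LinearMap.toSpanSingleton A L z)
  have hI : I = ⊤ := by
    by_contra hne
    obtain ⟨m, hm, hIm⟩ := Ideal.exists_le_maximal I hne
    obtain ⟨s, hs, hsz⟩ := h m hm.isPrime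
    exact hs (hIm hsz)
  have h1 : (1 : A) ∈ I := hI ▸ Submodule.mem_top
  change (1 : A) • z ∈ LinearMap.range (Algebra.linearMap A L) at h1
  rwa [one_smul] at h1

/-- A domain which is étale over an integrally closed domain is integrally closed. -/
lemma isIntegrallyClosed_of_etale (Q S : Type*) [CommRing Q] [IsDomain Q] [IsIntegrallyClosed Q]
    [CommRing S] [IsDomain S] [Algebra Q S] [Algebra.Etale Q S] : IsIntegrallyClosed S := by
  let F := FractionRing Q
  let E := TensorProduct Q S F
  have hQS : Function.Injective (algebraMap Q S) := by
    have : Module.Flat Q S := inferInstance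
    have := Module.Flat.isTorsionFree (R := Q) (M := S)
    exact FaithfulSMul.algebraMap_injective Q S
  have hM : Algebra.algebraMapSubmonoid S (nonZeroDivisors Q) ≤ nonZeroDivisors S := by
    rintro _ ⟨q, hq, rfl⟩
    rw [mem_nonZeroDivisors_iff_ne_zero, Ne, map_eq_zero_iff _ hQS]
    exact nonZeroDivisors.ne_zero hq
  have : IsLocalization (Algebra.algebraMapSubmonoid S (nonZeroDivisors Q)) E := inferInstance
  have : IsDomain E := IsLocalization.isDomain_of_le_nonZeroDivisors (R := S) E hM
  let : Algebra F E := Algebra.TensorProduct.rightAlgebra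
  -- `E` is étale over the field `F`, hence finite; as a localization of `S` it is a domain. So it
  -- is a field, namely the fraction field of `S`.
  have : Algebra.Etale F E := .of_equiv (Algebra.TensorProduct.commRight Q F S)
  have : Module.Finite F E := Algebra.FormallyUnramified.finite_of_free F E
  have hE : IsField E := isField_of_isIntegral_of_isField' (Field.toIsField F)
  have : IsFractionRing S E := IsLocalization.of_le
    (Algebra.algebraMapSubmonoid S (nonZeroDivisors Q)) (nonZeroDivisors S) hM fun r hr => by
      let := hE.toField
      rw [isUnit_iff_ne_zero, Ne, map_eq_zero_iff _ (IsLocalization.injective E hM)]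
      exact nonZeroDivisors.ne_zero hr
  rw [isIntegrallyClosed_iff E]
  intro x hx
  -- Integral closure commutes with smooth base change: that of `S` in `S ⊗ F` is `S ⊗ (integral
  -- closure of Q in F)`, which is `S ⊗ Q = S`.
  obtain ⟨z, hz⟩ := (TensorProduct.toIntegralClosure_bijective_of_smooth (R := Q) (S := S)
    (B := F)).2 ⟨x, hx⟩
  have hz' : x = TensorProduct.toIntegralClosure Q S F z := by rw [hz]
  rw [hz']
  clear hz hz' hx x
  induction z with
  | zero => exact ⟨0, by simp⟩
  | add a b ha hb =>
    obtain ⟨a', ha⟩ := ha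
    obtain ⟨b', hb⟩ := hb
    exact ⟨a' + b', by simp [ha, hb]⟩
  | tmul s y =>
    obtain ⟨q, hq⟩ := IsIntegrallyClosed.isIntegral_iff.1 y.2
    refine ⟨q • s, ?_⟩
    change (q • s) ⊗ₜ[Q] (1 : F) = s ⊗ₜ[Q] (y : F)
    rw [← hq, TensorProduct.smul_tmul, Algebra.smul_def, mul_one]

/-- Near each prime, `A` is étale over a polynomial ring, which is normal. An integral element of
`K` therefore lies in some `A_f` around each prime, hence in `A`. -/
lemma isIntegrallyClosed_of_smooth (k A : Type*) [Field k] [CommRing A] [IsDomain A] [Algebra k A]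
    [Algebra.Smooth k A] : IsIntegrallyClosed A := by
  let K := FractionRing A
  rw [isIntegrallyClosed_iff K]
  intro x hx
  change x ∈ LinearMap.range (Algebra.linearMap A K)
  refine mem_range_of_forall_prime x fun p hp => ?_
  have : Algebra.IsSmoothAt k p := by
    have := Algebra.smoothLocus_eq_univ (R := k) (A := A)
    exact this.ge (Set.mem_univ ⟨p, hp⟩)
  obtain ⟨f, hf, n, _, _, _⟩ := Algebra.IsSmoothAt.exists_isStandardEtale_mvPolynomial (R := k) (p := p)
  have hf0 : f ≠ 0 := by rintro rfl; exact hf (zero_mem _)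
  have hle := powers_le_nonZeroDivisors_of_noZeroDivisors hf0
  have : IsDomain (Localization.Away f) := IsLocalization.isDomain_localization hle
  have := isIntegrallyClosed_of_etale (MvPolynomial (Fin n) k) (Localization.Away f)
  let : Algebra (Localization.Away f) K := (IsLocalization.lift (M := .powers f) (g := algebraMap A K) (by
    rintro ⟨_, m, rfl⟩
    rw [map_pow, isUnit_iff_ne_zero]
    exact pow_ne_zero _ (by simpa using hf0))).toAlgebra
  have : IsScalarTower A (Localization.Away f) K := .of_algebraMap_eq' (by
    simp [RingHom.algebraMap_toAlgebra])
  have : IsFractionRing (Localization.Away f) K := IsFractionRing.isFractionRing_of_isDomain_of_isLocalization (.powers f) _ _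
  obtain ⟨y, rfl⟩ := IsIntegrallyClosed.isIntegral_iff.1 (hx.tower_top (A := Localization.Away f))
  obtain ⟨⟨a, s⟩, h⟩ := IsLocalization.surj (.powers f) y
  obtain ⟨m, hm⟩ := s.2
  refine ⟨f ^ m, fun h => hf (hp.mem_of_pow_mem _ h), a, ?_⟩
  rw [Algebra.linearMap_apply, IsScalarTower.algebraMap_apply A (Localization.Away f) K, ← h, map_mul,
    ← IsScalarTower.algebraMap_apply, Algebra.smul_def, mul_comm]
  simp only [← hm]

/-! ### Smoothness over a polynomial ring -/

/-- If `R` is formally smooth over `k` and carries derivations dual to `x`, then it is formally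
smooth over `k[X]`, where `X` acts by `x`. -/
lemma formallySmooth_mvPolynomial_of_derivations {k R σ : Type*} [CommRing k] [CommRing R]
    [Fintype σ] [DecidableEq σ] [Algebra k R] [Algebra.FormallySmooth k R]
    [Algebra (MvPolynomial σ k) R] [IsScalarTower k (MvPolynomial σ k) R]
    (D : σ → Derivation k R R)
    (hD : ∀ i j, D i (algebraMap (MvPolynomial σ k) R (.X j)) = if i = j then 1 else 0) :
    Algebra.FormallySmooth (MvPolynomial σ k) R := by
  refine Algebra.FormallySmooth.iff_comp_surjective.2 fun E _ _ I hI f => ?_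
  let : Algebra k E := ((algebraMap (MvPolynomial σ k) E).comp (algebraMap k _)).toAlgebra
  have : IsScalarTower k (MvPolynomial σ k) E := .of_algebraMap_eq' rfl
  have : IsScalarTower k (MvPolynomial σ k) (E ⧸ I) := .of_algebraMap_eq' rfl
  obtain ⟨g, hg⟩ := Algebra.FormallySmooth.comp_surjective k R I hI (f.restrictScalars k)
  let : Algebra R E := g.toRingHom.toAlgebra
  have : IsScalarTower k R E := .of_algebraMap_eq' g.comp_algebraMap.symm
  have hg' : ∀ a, Ideal.Quotient.mk I (g a) = f a := fun a => DFunLike.congr_fun hg a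
  have he : ∀ j, algebraMap (MvPolynomial σ k) E (.X j) -
      g (algebraMap (MvPolynomial σ k) R (.X j)) ∈ I := fun j => by
    rw [← Ideal.Quotient.eq, hg', f.commutes]
    rfl
  -- The `k`-linear lift `g` misses `k[X]`-linearity by errors in the square-zero ideal `I`. Since
  -- the `D j` are dual to the `X_j`, adding the derivation `∑ (error at X_j) · D j` corrects all of
  -- them at once.
  let δ : Derivation k R I := ∑ j, (LinearMap.toSpanSingleton R I ⟨_, he j⟩).compDer (D j)
  let h := liftOfDerivationToSquareZero I hI δ
  have hh : ∀ a, h a = δ a + g a := fun a => rfl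
  have hX : ∀ j, h (algebraMap (MvPolynomial σ k) R (.X j)) =
      algebraMap (MvPolynomial σ k) E (.X j) := fun j => by
    have : δ (algebraMap (MvPolynomial σ k) R (.X j)) = ⟨_, he j⟩ := by
      change Derivation.coeFnAddMonoidHom δ _ = _
      simp [δ, hD]
    rw [hh, this, sub_add_cancel]
  have hcomm : h.comp (IsScalarTower.toAlgHom k (MvPolynomial σ k) R) =
      IsScalarTower.toAlgHom k (MvPolynomial σ k) E := MvPolynomial.algHom_ext hX
  refine ⟨{ h with commutes' := fun a => DFunLike.congr_fun hcomm a }, ?_⟩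
  ext a
  change Ideal.Quotient.mk I (δ a + g a) = f a
  rw [map_add, hg', Ideal.Quotient.eq_zero_iff_mem.2 (δ a).2, zero_add]

/-- Coordinate functionals on the cotangent space given by regular parameters. -/
lemma exists_coord_cotangent {R : Type*} [CommRing R] [IsLocalRing R] [IsNoetherianRing R] {n : ℕ}
    (y : Fin n → R) (hy : IsRegularSystemOfParameters y) :
    ∃ (hm : ∀ i, y i ∈ IsLocalRing.maximalIdeal R)
      (c : Fin n → (IsLocalRing.maximalIdeal R).Cotangent →ₗ[R] IsLocalRing.ResidueField R),
      ∀ i j, c i ((IsLocalRing.maximalIdeal R).toCotangent ⟨y j, hm j⟩) = if i = j then 1 else 0 := by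
  have hm : ∀ i, y i ∈ IsLocalRing.maximalIdeal R :=
    fun i => hy.1 ▸ Ideal.subset_span ⟨i, rfl⟩
  let v : Fin n → IsLocalRing.CotangentSpace R :=
    fun j => (IsLocalRing.maximalIdeal R).toCotangent ⟨y j, hm j⟩
  have hspan : Submodule.span (IsLocalRing.ResidueField R) (Set.range v) = ⊤ := by
    have h : Set.range v = (IsLocalRing.maximalIdeal R).toCotangent ''
        Set.range fun j => (⟨y j, hm j⟩ : IsLocalRing.maximalIdeal R) := by
      rw [← Set.range_comp]
      rfl
    rw [h, IsLocalRing.CotangentSpace.span_image_eq_top_iff]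
    apply Submodule.map_injective_of_injective (IsLocalRing.maximalIdeal R).subtype_injective
    rw [Submodule.map_span, ← Set.range_comp, Submodule.map_top, Submodule.range_subtype]
    exact hy.1
  -- The `n` classes span the cotangent space, and `n = dim R` is at most its dimension; so they
  -- form a basis.
  have hcard : Fintype.card (Fin n) =
      Module.finrank (IsLocalRing.ResidueField R) (IsLocalRing.CotangentSpace R) := by
    apply le_antisymm
    · rw [Fintype.card_fin, ← IsLocalRing.spanFinrank_maximalIdeal_eq_finrank_cotangentSpace]
      have := ringKrullDim_le_spanFinrank_maximalIdeal R
      rw [← hy.2] at this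
      exact_mod_cast this
    · rw [← finrank_top (IsLocalRing.ResidueField R) (IsLocalRing.CotangentSpace R), ← hspan]
      exact finrank_range_le_card v
  let b := Module.Basis.mk (linearIndependent_of_top_le_span_of_card_eq_finrank hspan.ge hcard) hspan.ge
  refine ⟨hm, fun i => (b.coord i).restrictScalars R, fun i j => ?_⟩
  have : b j = v j := Module.Basis.mk_apply _ _ _
  change b.coord i (v j) = _
  rw [← this, Module.Basis.coord_apply, Module.Basis.repr_self, Finsupp.single_apply]
  simp [eq_comm]

/-- In characteristic zero the residue field `κ` is formally smooth over `k`, so `m/m² → κ ⊗ Ω`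
splits. The coordinate functionals on `m/m²` extend to `Ω` with values in `κ`, and lift to `R`
because `Ω` is projective. The lifts are dual to `dy_j` only modulo `m`; their matrix is invertible,
and its inverse makes the duality exact. -/
lemma exists_dual_derivations {k R : Type*} [Field k] [CharZero k] [CommRing R] [IsLocalRing R]
    [IsNoetherianRing R] [Algebra k R] [Algebra.EssFiniteType k R] [Algebra.FormallySmooth k R]
    {n : ℕ} (y : Fin n → R) (hy : IsRegularSystemOfParameters y) :
    ∃ D : Fin n → Derivation k R R, ∀ i j, D i (y j) = if i = j then 1 else 0 := by
  let κ := IsLocalRing.ResidueField R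
  have : Algebra.EssFiniteType k κ := .comp k R κ
  obtain ⟨l, hl⟩ := (Algebra.FormallySmooth.iff_split_injection (R := k) (A := κ) (P := R)
    IsLocalRing.residue_surjective).1 inferInstance
  obtain ⟨hm, c, hc⟩ : ∃ (hm : ∀ i, y i ∈ RingHom.ker (algebraMap R κ))
      (c : Fin n → (RingHom.ker (algebraMap R κ)).Cotangent →ₗ[R] κ),
      ∀ i j, c i ((RingHom.ker (algebraMap R κ)).toCotangent ⟨y j, hm j⟩) =
        if i = j then 1 else 0 := by
    have hker : RingHom.ker (algebraMap R κ) = IsLocalRing.maximalIdeal R := IsLocalRing.ker_residue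
    rw [hker]
    exact exists_coord_cotangent y hy
  let μ : Fin n → Ω[R⁄k] →ₗ[R] κ := fun i => c i ∘ₗ l ∘ₗ TensorProduct.mk R κ Ω[R⁄k] 1
  have hμ : ∀ i j, μ i (KaehlerDifferential.D k R (y j)) = if i = j then 1 else 0 := fun i j => by
    rw [← hc i j]
    change c i (l (1 ⊗ₜ KaehlerDifferential.D k R (y j))) = _
    congr 1
    rw [← KaehlerDifferential.kerCotangentToTensor_toCotangent k R κ ⟨y j, hm j⟩]
    exact LinearMap.congr_fun hl _
  choose ν hν using fun i => Module.projective_lifting_property (Algebra.linearMap R κ) (μ i)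
    IsLocalRing.residue_surjective
  let M : Matrix (Fin n) (Fin n) R := fun i j => ν i (KaehlerDifferential.D k R (y j))
  have hM : M.map (algebraMap R κ) = 1 := by
    ext i j
    rw [Matrix.map_apply, Matrix.one_apply, ← hμ, ← hν]
    rfl
  have hdet : IsUnit M.det := by
    apply isUnit_of_map_unit (IsLocalRing.residue R)
    rw [RingHom.map_det]
    change IsUnit (M.map (algebraMap R κ)).det
    rw [hM]
    simp
  refine ⟨fun i => (∑ t, M⁻¹ i t • ν t).compDer (KaehlerDifferential.D k R), fun i j => ?_⟩
  have := congr_fun₂ (Matrix.nonsing_inv_mul M hdet) i j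
  rw [Matrix.mul_apply, Matrix.one_apply] at this
  rw [← this]
  simp [M]

/-! ### Consequences of regular parameters: smoothness over `k[x]` and Eisenstein irreducibility. -/

section RegularParameters

variable {k A : Type*} [Field k] [CharZero k] [CommRing A] [Algebra k A] [Algebra.Smooth k A]
  {r : ℕ} {x : Fin r → A}

lemma IsRegularParameters.exists_derivations (hx : IsRegularParameters x) {p : Ideal A} [p.IsPrime]
    (hp : ∀ i, x i ∈ p) :
    ∃ D : Fin r → Derivation k (Localization.AtPrime p) (Localization.AtPrime p),
      ∀ i j, D i (algebraMap A _ (x j)) = if i = j then 1 else 0 := by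
  have : IsNoetherianRing A := Algebra.FiniteType.isNoetherianRing k A
  have : IsNoetherianRing (Localization.AtPrime p) :=
    IsLocalization.isNoetherianRing p.primeCompl _ inferInstance
  have : Algebra.EssFiniteType A (Localization.AtPrime p) := .of_isLocalization _ p.primeCompl
  have : Algebra.EssFiniteType k (Localization.AtPrime p) := .comp _ A _
  have : Algebra.FormallySmooth A (Localization.AtPrime p) := .of_isLocalization p.primeCompl
  have : Algebra.FormallySmooth k (Localization.AtPrime p) := .comp _ A _
  obtain ⟨s, z, hz⟩ := hx.extend ⟨p, inferInstance⟩ (by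
    rintro _ ⟨i, rfl⟩
    exact hp i)
  obtain ⟨D, hD⟩ := exists_dual_derivations (k := k) _ hz
  refine ⟨fun i => D (Fin.castAdd s i), fun i j => ?_⟩
  have := hD (Fin.castAdd s i) (Fin.castAdd s j)
  rw [Fin.append_left] at this
  rw [this]
  simp

/-- A derivation maps `p²` into the maximal ideal of `A_p`, whereas `D i (x i) = 1`. -/
lemma IsRegularParameters.notMem_sq (k : Type*) [Field k] [CharZero k] [Algebra k A]
    [Algebra.Smooth k A] (hx : IsRegularParameters x) {p : Ideal A}
    [p.IsPrime] (hp : ∀ i, x i ∈ p) (i : Fin r) : x i ∉ p ^ 2 := by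
  obtain ⟨D, hD⟩ := hx.exists_derivations (k := k) hp
  have key : ∀ a ∈ p ^ 2, D i (algebraMap A (Localization.AtPrime p) a) ∈
      IsLocalRing.maximalIdeal (Localization.AtPrime p) := fun a ha => by
    rw [pow_two] at ha
    have hmem : ∀ b ∈ p, algebraMap A (Localization.AtPrime p) b ∈
        IsLocalRing.maximalIdeal (Localization.AtPrime p) := fun b hb =>
      (IsLocalization.AtPrime.to_map_mem_maximal_iff (Localization.AtPrime p) p b).2 hb
    refine Submodule.mul_induction_on ha (fun b hb c hc => ?_) fun b c hb hc => ?_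
    · rw [map_mul, Derivation.leibniz]
      exact add_mem (Ideal.mul_mem_right _ _ (hmem b hb)) (Ideal.mul_mem_right _ _ (hmem c hc))
    · rw [map_add, map_add]
      exact add_mem hb hc
  intro h
  have := key _ h
  rw [hD, if_pos rfl] at this
  exact (IsLocalRing.maximalIdeal.isMaximal _).ne_top ((Ideal.eq_top_iff_one _).2 this)

/-- The dual derivations give formal smoothness of `A_p` over `k[x]`; the smooth locus is open. -/
lemma IsRegularParameters.exists_smooth_away [Algebra (MvPolynomial (Fin r) k) A]
    [IsScalarTower k (MvPolynomial (Fin r) k) A]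
    (hX : ∀ j, algebraMap (MvPolynomial (Fin r) k) A (.X j) = x j)
    (hx : IsRegularParameters x) {p : Ideal A} [p.IsPrime] (hp : ∀ i, x i ∈ p) :
    ∃ g ∉ p, Algebra.Smooth (MvPolynomial (Fin r) k) (Localization.Away g) := by
  obtain ⟨D, hD⟩ := hx.exists_derivations (k := k) hp
  have : Algebra.FormallySmooth A (Localization.AtPrime p) := .of_isLocalization p.primeCompl
  have : Algebra.FormallySmooth k (Localization.AtPrime p) := .comp _ A _
  have : Algebra.FiniteType (MvPolynomial (Fin r) k) A := .of_restrictScalars_finiteType k _ _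
  have : Algebra.FinitePresentation (MvPolynomial (Fin r) k) A :=
    Algebra.FinitePresentation.of_finiteType.1 inferInstance
  have : IsScalarTower k (MvPolynomial (Fin r) k) (Localization.AtPrime p) :=
    .of_algebraMap_eq fun a => by
      rw [IsScalarTower.algebraMap_apply (MvPolynomial (Fin r) k) A,
        ← IsScalarTower.algebraMap_apply k, IsScalarTower.algebraMap_apply k A]
  have : Algebra.IsSmoothAt (MvPolynomial (Fin r) k) p :=
    formallySmooth_mvPolynomial_of_derivations D fun i j => by
      rw [IsScalarTower.algebraMap_apply (MvPolynomial (Fin r) k) A, hX, hD]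
  exact Algebra.IsSmoothAt.exists_notMem_smooth _ p

/-- Eisenstein's criterion at a prime of `V(x)` gives irreducibility over `A`; as `A` is normal,
Gauss's lemma carries it to the fraction field. -/
lemma IsRegularParameters.irreducible (k : Type*) [Field k] [CharZero k] [Algebra k A]
    [Algebra.Smooth k A] [IsDomain A] (hx : IsRegularParameters x) (i : Fin r) {n : ℕ}
    (hn : 0 < n) :
    Irreducible ((X ^ n - C (x i) : A[X]).map (algebraMap A (FractionRing A))) := by
  have := isIntegrallyClosed_of_smooth k A
  have hmonic : (X ^ n - C (x i) : A[X]).Monic := monic_X_pow_sub_C _ hn.ne'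
  rw [← hmonic.irreducible_iff_irreducible_map_fraction_map]
  obtain ⟨⟨p, hp⟩, hpx⟩ := hx.nonempty
  have hpx' : ∀ j, x j ∈ p := fun j => hpx ⟨j, rfl⟩
  have hdeg : (X ^ n - C (x i) : A[X]).degree = n := degree_X_pow_sub_C hn _
  refine irreducible_of_eisenstein_criterion hp ?_ ?_ ?_ ?_ hmonic.isPrimitive
  · rw [hmonic.leadingCoeff]
    exact fun h => hp.ne_top ((Ideal.eq_top_iff_one _).2 h)
  · intro m hm
    rw [hdeg, Nat.cast_lt] at hm
    rw [coeff_sub, coeff_X_pow, if_neg hm.ne, zero_sub, coeff_C]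
    split_ifs
    · exact neg_mem (hpx' i)
    · simp
  · rw [hdeg]
    exact_mod_cast hn
  · rw [coeff_sub, coeff_X_pow, if_neg hn.ne, zero_sub, coeff_C_zero, neg_mem_iff]
    exact hx.notMem_sq k hpx' i

lemma IsRegularParameters.ne_zero (k : Type*) [Field k] [CharZero k] [Algebra k A]
    [Algebra.Smooth k A] (hx : IsRegularParameters x) (i : Fin r) : x i ≠ 0 := by
  obtain ⟨⟨p, hp⟩, hpx⟩ := hx.nonempty
  intro h
  apply hx.notMem_sq k (p := p) (fun j => hpx ⟨j, rfl⟩) i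
  rw [h]
  exact zero_mem _

end RegularParameters

/-! ### The chart as a base change of a weighted toric chart -/

/-- The coordinate ring `k[u, x'_j]` of the `i`-th chart of the weighted blow-up of affine space,
as an algebra over the coordinate ring of affine space. -/
def WeightedPoly (k : Type u) [Field k] {r : ℕ} (_w : Fin r → ℕ+) (_i : Fin r) : Type u :=
  MvPolynomial (Fin r) k

namespace WeightedPoly

variable (k : Type u) [Field k] {r : ℕ} (w : Fin r → ℕ+) (i : Fin r)

noncomputable instance : CommRing (WeightedPoly k w i) :=
  inferInstanceAs (CommRing (MvPolynomial (Fin r) k))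

instance : IsDomain (WeightedPoly k w i) := inferInstanceAs (IsDomain (MvPolynomial (Fin r) k))

noncomputable instance : Algebra k (WeightedPoly k w i) :=
  inferInstanceAs (Algebra k (MvPolynomial (Fin r) k))

instance : Algebra.Smooth k (WeightedPoly k w i) :=
  have : Algebra.FormallySmooth k (MvPolynomial (Fin r) k) := inferInstance
  have : Algebra.Smooth k (MvPolynomial (Fin r) k) := ⟨this, inferInstance⟩
  this

/-- The variables of `k[u, x'_j]`; the one with index `i` is `u`. -/
noncomputable def var (j : Fin r) : WeightedPoly k w i := (MvPolynomial.X j : MvPolynomial (Fin r) k)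

variable {k w i}

lemma var_ne_zero (j : Fin r) : var k w i j ≠ 0 := MvPolynomial.X_ne_zero (R := k) j

/-- Evaluation of `k[u, x'_j]`. -/
noncomputable def aeval {S : Type*} [CommRing S] [Algebra k S] (s : Fin r → S) :
    WeightedPoly k w i →ₐ[k] S := (MvPolynomial.aeval s : MvPolynomial (Fin r) k →ₐ[k] S)

@[simp] lemma aeval_var {S : Type*} [CommRing S] [Algebra k S] (s : Fin r → S) (j : Fin r) :
    aeval s (var k w i j) = s j := MvPolynomial.aeval_X (R := k) s j

lemma ringHom_ext {S : Type*} [CommRing S] {f g : WeightedPoly k w i →+* S}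
    (h : ∀ a : k, f (algebraMap k _ a) = g (algebraMap k _ a))
    (h' : ∀ j, f (var k w i j) = g (var k w i j)) : f = g :=
  MvPolynomial.ringHom_ext (R := k) h h'

lemma induction_on {motive : WeightedPoly k w i → Prop} (p : WeightedPoly k w i)
    (algebraMap : ∀ a : k, motive (algebraMap k _ a))
    (add : ∀ p q, motive p → motive q → motive (p + q))
    (mul_var : ∀ p j, motive p → motive (p * var k w i j)) : motive p :=
  MvPolynomial.induction_on (R := k) p algebraMap add mul_var

variable (k w i) in
/-- The images of the coordinates of affine space: `u^{w_i}` and `x'_j u^{w_j}`. -/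
noncomputable def coord (j : Fin r) : WeightedPoly k w i :=
  if j = i then var k w i i ^ (w i : ℕ) else var k w i j * var k w i i ^ (w j : ℕ)

/-- This is not the structure of a polynomial ring over itself: `X_j` acts by `coord j`. The type
synonym keeps the two apart. -/
noncomputable instance : Algebra (MvPolynomial (Fin r) k) (WeightedPoly k w i) :=
  (MvPolynomial.aeval (coord k w i)).toRingHom.toAlgebra

instance : IsScalarTower k (MvPolynomial (Fin r) k) (WeightedPoly k w i) :=
  .of_algebraMap_eq' (MvPolynomial.aeval (coord k w i)).comp_algebraMap.symm

lemma algebraMap_X (j : Fin r) :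
    algebraMap (MvPolynomial (Fin r) k) (WeightedPoly k w i) (.X j) = coord k w i j :=
  MvPolynomial.aeval_X _ _

end WeightedPoly

lemma WeightedPoly.aeval_coord {k : Type u} [Field k] {r : ℕ} {w : Fin r → ℕ+} {i : Fin r}
    {A L : Type*} [CommRing A] [CommRing L] [Algebra k L] [Algebra A L] {x : Fin r → A}
    (θ : Lˣ) (hθ : (θ : L) ^ (w i : ℕ) = algebraMap A L (x i)) (j : Fin r) :
    WeightedPoly.aeval (k := k) (w := w) (i := i)
      (fun j => if j = i then (θ : L) else algebraMap A L (x j) * (θ⁻¹ ^ (w j : ℕ) : Lˣ))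
      (WeightedPoly.coord k w i j) = algebraMap A L (x j) := by
  by_cases hj : j = i
  · subst hj
    simp [WeightedPoly.coord, hθ]
  · simp only [WeightedPoly.coord, if_neg hj, map_mul, map_pow, WeightedPoly.aeval_var, if_true]
    rw [mul_assoc, ← Units.val_pow_eq_pow_val, ← Units.val_mul, ← mul_pow]
    simp

/-- The coordinate ring `A ⊗ k[u, x'_j]` over `k[x_1, …, x_r]`. -/
abbrev CoordRing (k : Type u) [Field k] (A : Type u) [CommRing A] {r : ℕ}
    [Algebra (MvPolynomial (Fin r) k) A] (w : Fin r → ℕ+) (i : Fin r) : Type u :=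
  WeightedPoly k w i ⊗[MvPolynomial (Fin r) k] A

namespace CoordRing

variable {k A : Type u} [Field k] [CommRing A] {r : ℕ} [Algebra (MvPolynomial (Fin r) k) A]
  {w : Fin r → ℕ+} {i : Fin r}

variable (k w i) in
/-- The map `A → A ⊗ k[u, x'_j]`. -/
noncomputable def incl : A →ₐ[MvPolynomial (Fin r) k] CoordRing k A w i :=
  Algebra.TensorProduct.includeRight

variable (k A w i) in
/-- The variables `u` (for the index `i`) and `x'_j`. -/
noncomputable def var (j : Fin r) : CoordRing k A w i :=
  algebraMap (WeightedPoly k w i) _ (WeightedPoly.var k w i j)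

section

variable {x : Fin r → A} (hX : ∀ j, algebraMap (MvPolynomial (Fin r) k) A (.X j) = x j)
include hX

lemma algebraMap_coord (j : Fin r) :
    algebraMap (WeightedPoly k w i) (CoordRing k A w i) (WeightedPoly.coord k w i j) =
      incl k w i (x j) := by
  rw [← WeightedPoly.algebraMap_X, ← IsScalarTower.algebraMap_apply, ← hX, AlgHom.commutes]

lemma var_pow : var k A w i i ^ (w i : ℕ) = incl k w i (x i) := by
  rw [← algebraMap_coord hX, WeightedPoly.coord, if_pos rfl, map_pow]
  rfl

lemma var_mul_pow {j : Fin r} (hj : j ≠ i) :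
    var k A w i j * var k A w i i ^ (w j : ℕ) = incl k w i (x j) := by
  rw [← algebraMap_coord hX, WeightedPoly.coord, if_neg hj, map_mul, map_pow]
  rfl

/-- The exceptional divisor `u = 0` lies over `V(x)`, the only place where regular parameters give
information. -/
lemma mem_of_var_mem {q : Ideal (CoordRing k A w i)} (hq : var k A w i i ∈ q) (j : Fin r) :
    incl k w i (x j) ∈ q := by
  by_cases hj : j = i
  · subst hj
    rw [← var_pow hX]
    exact Ideal.pow_mem_of_mem _ hq _ (w j).pos
  · rw [← var_mul_pow hX hj]
    exact Ideal.mul_mem_left _ _ (Ideal.pow_mem_of_mem _ hq _ (w j).pos)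

end

section Hom

variable {x : Fin r → A} (hX : ∀ j, algebraMap (MvPolynomial (Fin r) k) A (.X j) = x j)
variable {L : Type*} [CommRing L] [Algebra k L] [Algebra A L] [Algebra (MvPolynomial (Fin r) k) L]
  [IsScalarTower k (MvPolynomial (Fin r) k) L] [IsScalarTower (MvPolynomial (Fin r) k) A L]

/-- The map from the coordinate ring given by an invertible `w_i`-th root of `x_i`. -/
noncomputable def lift (θ : Lˣ) (hθ : (θ : L) ^ (w i : ℕ) = algebraMap A L (x i)) :
    CoordRing k A w i →ₐ[MvPolynomial (Fin r) k] L :=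
  Algebra.TensorProduct.productMap
    { WeightedPoly.aeval (k := k) (w := w) (i := i)
        fun j => if j = i then (θ : L) else algebraMap A L (x j) * (θ⁻¹ ^ (w j : ℕ) : Lˣ) with
      commutes' := fun p => by
        have : (WeightedPoly.aeval (k := k) (w := w) (i := i) fun j => if j = i then (θ : L)
            else algebraMap A L (x j) * (θ⁻¹ ^ (w j : ℕ) : Lˣ)).comp
            (IsScalarTower.toAlgHom k (MvPolynomial (Fin r) k) (WeightedPoly k w i)) =
            IsScalarTower.toAlgHom k (MvPolynomial (Fin r) k) L := by
          refine MvPolynomial.algHom_ext fun j => ?_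
          rw [AlgHom.comp_apply, IsScalarTower.coe_toAlgHom', IsScalarTower.coe_toAlgHom',
            WeightedPoly.algebraMap_X, WeightedPoly.aeval_coord θ hθ,
            IsScalarTower.algebraMap_apply (MvPolynomial (Fin r) k) A L, hX]
        exact DFunLike.congr_fun this p }
    (IsScalarTower.toAlgHom (MvPolynomial (Fin r) k) A L)

lemma lift_incl (θ : Lˣ) (hθ : (θ : L) ^ (w i : ℕ) = algebraMap A L (x i)) (a : A) :
    lift hX θ hθ (incl k w i a) = algebraMap A L a := by
  simp [lift, incl]

lemma lift_var_self (θ : Lˣ) (hθ : (θ : L) ^ (w i : ℕ) = algebraMap A L (x i)) :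
    lift hX θ hθ (var k A w i i) = θ := by
  simp [lift, var, Algebra.TensorProduct.algebraMap_apply]

lemma lift_var (θ : Lˣ) (hθ : (θ : L) ^ (w i : ℕ) = algebraMap A L (x i)) {j : Fin r} (hj : j ≠ i) :
    lift hX θ hθ (var k A w i j) = algebraMap A L (x j) * (θ⁻¹ ^ (w j : ℕ) : Lˣ) := by
  simp [lift, var, Algebra.TensorProduct.algebraMap_apply, hj]

end Hom

variable [Algebra k A] [IsScalarTower k (MvPolynomial (Fin r) k) A]

lemma algebraMap_eq (a : k) :
    algebraMap k (CoordRing k A w i) a = incl k w i (algebraMap k A a) := by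
  rw [IsScalarTower.algebraMap_apply k (MvPolynomial (Fin r) k) A, AlgHom.commutes,
    ← IsScalarTower.algebraMap_apply]

lemma ringHom_ext {S : Type*} [CommRing S] {f g : CoordRing k A w i →+* S}
    (h : ∀ a, f (incl k w i a) = g (incl k w i a))
    (h' : ∀ j, f (var k A w i j) = g (var k A w i j)) : f = g := by
  ext a
  · exact RingHom.congr_fun (WeightedPoly.ringHom_ext (f := f.comp (algebraMap _ _))
      (g := g.comp (algebraMap _ _)) (fun a => by
        rw [RingHom.comp_apply, RingHom.comp_apply, ← IsScalarTower.algebraMap_apply, algebraMap_eq,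
          h]) h') a
  · exact h a

variable {x : Fin r → A} (hX : ∀ j, algebraMap (MvPolynomial (Fin r) k) A (.X j) = x j)

include hX in
/-- After multiplication by a power of `u`, each element is a polynomial in `u` over `A`. -/
lemma exists_pow_mul_eq (c : CoordRing k A w i) :
    ∃ (N : ℕ) (F : A[X]), var k A w i i ^ N * c =
      F.eval₂ (incl k w i).toRingHom (var k A w i i) := by
  induction c using TensorProduct.induction_on with
  | zero => exact ⟨0, 0, by simp⟩
  | add a b ha hb =>
    obtain ⟨N, F, hF⟩ := ha
    obtain ⟨M, G, hG⟩ := hb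
    refine ⟨N + M, X ^ M * F + X ^ N * G, ?_⟩
    rw [eval₂_add, eval₂_mul, eval₂_mul, eval₂_X_pow, eval₂_X_pow, ← hF, ← hG]
    ring
  | tmul p a =>
    have hp : p ⊗ₜ[MvPolynomial (Fin r) k] a = algebraMap (WeightedPoly k w i) _ p * incl k w i a := by
      simp [incl]
    suffices h : ∃ (N : ℕ) (F : A[X]),
        var k A w i i ^ N * algebraMap (WeightedPoly k w i) (CoordRing k A w i) p =
        F.eval₂ (incl k w i).toRingHom (var k A w i i) by
      obtain ⟨N, F, h⟩ := h
      refine ⟨N, F * C a, ?_⟩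
      rw [hp, eval₂_mul, ← h, eval₂_C, mul_assoc]
      rfl
    clear hp
    induction p using WeightedPoly.induction_on with
    | algebraMap a =>
      refine ⟨0, C (algebraMap k A a), ?_⟩
      rw [pow_zero, one_mul, eval₂_C, ← IsScalarTower.algebraMap_apply k]
      exact algebraMap_eq a
    | add p q hp hq =>
      obtain ⟨N, F, hF⟩ := hp
      obtain ⟨M, G, hG⟩ := hq
      refine ⟨N + M, X ^ M * F + X ^ N * G, ?_⟩
      rw [eval₂_add, eval₂_mul, eval₂_mul, eval₂_X_pow, eval₂_X_pow, ← hF, ← hG, map_add]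
      ring
    | mul_var p j hp =>
      obtain ⟨N, F, hF⟩ := hp
      by_cases hj : j = i
      · subst hj
        refine ⟨N, F * X, ?_⟩
        rw [map_mul, eval₂_mul, eval₂_X, ← hF, mul_assoc]
        rfl
      · refine ⟨N + w j, F * C (x j), ?_⟩
        rw [map_mul, eval₂_mul, eval₂_C, ← hF, pow_add]
        change _ * (_ * var k A w i j) = _ * incl k w i (x j)
        rw [← var_mul_pow hX hj]
        ring

end CoordRing

/-! ### Smoothness of the coordinate ring and its embedding in an extension field. -/

lemma eq_zero_of_forall_prime {A : Type*} [CommRing A] (z : A)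
    (h : ∀ p : Ideal A, p.IsPrime → ∃ s ∉ p, s * z = 0) : z = 0 := by
  by_contra hz
  have hne : Ideal.span {z} ≠ ⊥ := by simpa using hz
  have hne' : (Ideal.span {z}).annihilator ≠ ⊤ := by
    rwa [Ne, Submodule.annihilator_eq_top_iff]
  obtain ⟨m, hm, hIm⟩ := Ideal.exists_le_maximal _ hne'
  obtain ⟨s, hs, hsz⟩ := h m hm.isPrime
  exact hs (hIm ((Submodule.mem_annihilator_span_singleton _ _).2 hsz))

namespace CoordRing

variable {k A : Type u} [Field k] [CharZero k] [CommRing A] [Algebra k A] [Algebra.Smooth k A]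
  {r : ℕ} [Algebra (MvPolynomial (Fin r) k) A] [IsScalarTower k (MvPolynomial (Fin r) k) A]
  {w : Fin r → ℕ+} {i : Fin r}
  {x : Fin r → A} (hX : ∀ j, algebraMap (MvPolynomial (Fin r) k) A (.X j) = x j)

include hX in
/-- The coordinate ring is smooth over `k[u, x'_j]` near the exceptional divisor `u = 0`. -/
lemma exists_smooth_away (hx : IsRegularParameters x) {q : Ideal (CoordRing k A w i)} [q.IsPrime]
    (hq : var k A w i i ∈ q) :
    ∃ g ∉ q, Algebra.Smooth (WeightedPoly k w i) (Localization.Away g) := by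
  obtain ⟨g, hg, _⟩ := hx.exists_smooth_away (k := k) hX
    (p := q.comap (incl k w i)) fun j => mem_of_var_mem hX hq j
  exact ⟨incl k w i g, hg, .of_equiv
    (IsLocalization.Away.tensorProductEquivTMulRight _ (WeightedPoly k w i) g (Localization.Away g))⟩

include hX in
/-- The coordinate ring is étale over `A` outside the exceptional divisor `u = 0`. -/
lemma smooth_away_var :
    Algebra.Smooth k (Localization.Away (var k A w i i)) := by
  let U := Localization.Away (var k A w i i)
  let π : CoordRing k A w i →+* U := algebraMap _ _
  let : Algebra A U := (π.comp (incl k w i).toRingHom).toAlgebra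
  have : IsScalarTower k A U := .of_algebraMap_eq fun a => by
    rw [IsScalarTower.algebraMap_apply k (CoordRing k A w i) U, algebraMap_eq]
    rfl
  let P : StandardEtalePair A :=
    { f := X ^ (w i : ℕ) - C (x i)
      monic_f := monic_X_pow_sub_C _ (w i).ne_zero
      g := X
      -- The derivative of `X^w - x_i` is `w X^{w-1}`; multiplied by `1/w` it is the power `w - 1`
      -- of `g = X`.
      cond := ⟨C (algebraMap k A (w i : k)⁻¹), 0, (w i : ℕ) - 1, by
        have h : ((w i : ℕ) : k) * (w i : k)⁻¹ = 1 :=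
          mul_inv_cancel₀ (by exact_mod_cast (w i).ne_zero)
        have h' : (((w i : ℕ) : A[X])) * C (algebraMap k A (w i : k)⁻¹) = 1 := by
          rw [← map_natCast C, ← C_mul, ← map_natCast (algebraMap k A), ← map_mul, h, map_one, C_1]
        rw [derivative_sub, derivative_C, derivative_X_pow, mul_zero, add_zero, sub_zero,
          mul_right_comm, map_natCast, h', one_mul]⟩ }
  have hu : IsUnit (π (var k A w i i)) := IsLocalization.Away.algebraMap_isUnit _
  have hmap : P.HasMap (π (var k A w i i)) := by
    refine ⟨?_, by simpa [P] using hu⟩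
    simp only [P, map_sub, map_pow, aeval_X, aeval_C]
    rw [← map_pow, var_pow hX, sub_eq_zero]
    rfl
  let f : P.Ring →ₐ[A] U := P.lift _ hmap
  let : Algebra (MvPolynomial (Fin r) k) P.Ring :=
    ((algebraMap A P.Ring).comp (algebraMap (MvPolynomial (Fin r) k) A)).toAlgebra
  let : Algebra k P.Ring := ((algebraMap A P.Ring).comp (algebraMap k A)).toAlgebra
  have : IsScalarTower (MvPolynomial (Fin r) k) A P.Ring := .of_algebraMap_eq' rfl
  have : IsScalarTower k (MvPolynomial (Fin r) k) P.Ring := .of_algebraMap_eq fun a =>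
    congrArg (algebraMap A P.Ring) (IsScalarTower.algebraMap_apply k (MvPolynomial (Fin r) k) A a)
  have hunit : IsUnit P.X := by simpa [P] using P.hasMap_X.2
  have hroot : (hunit.unit : P.Ring) ^ (w i : ℕ) = algebraMap A P.Ring (x i) := by
    have := P.hasMap_X.1
    simpa [P, sub_eq_zero] using this
  let g₀ := (lift hX hunit.unit hroot).toRingHom
  have hg₀ : IsUnit (g₀ (var k A w i i)) := by
    change IsUnit (lift hX hunit.unit hroot (var k A w i i))
    rw [lift_var_self]
    exact hunit.unit.isUnit
  let g : U →+* P.Ring := IsLocalization.Away.lift (var k A w i i) hg₀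
  have hgπ : ∀ c, g (π c) = lift hX hunit.unit hroot c := fun c => IsLocalization.Away.lift_eq _ hg₀ c
  have hfX : f P.X = π (var k A w i i) := P.lift_X _ hmap
  let g' : U →ₐ[A] P.Ring := { g with commutes' := fun a => (hgπ _).trans (lift_incl hX _ hroot a) }
  have h1 : g'.comp f = .id A _ := P.hom_ext (by
    change g (f P.X) = P.X
    rw [hfX, hgπ, lift_var_self]
    rfl)
  have h2 : f.comp g' = .id A _ := by
    have : (f.toRingHom.comp g).comp π = π := by
      refine ringHom_ext (fun a => ?_) fun j => ?_
      · change f (g (π _)) = _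
        rw [hgπ, lift_incl, AlgHom.commutes]
        rfl
      · change f (g (π _)) = _
        by_cases hj : j = i
        · subst hj
          rw [hgπ, lift_var_self]
          exact hfX
        · rw [hgπ, lift_var _ _ _ hj, map_mul, AlgHom.commutes]
          -- Away from `u = 0`, `x'_j` is determined by `x'_j u^{w_j} = x_j`, so the comparison is
          -- made after multiplying by the unit `u^{w_j}`.
          apply (hu.pow (w j)).mul_right_cancel
          rw [← map_pow, ← map_mul, var_mul_pow hX hj, map_pow, ← hfX, ← map_pow, mul_assoc, ← map_mul]
          have : ((hunit.unit⁻¹ ^ (w j : ℕ) : P.Ringˣ) : P.Ring) * P.X ^ (w j : ℕ) = 1 := by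
            rw [inv_pow]
            exact (hunit.unit ^ (w j : ℕ)).inv_mul
          rw [this, map_one, mul_one]
          rfl
    refine AlgHom.ext fun z => ?_
    exact RingHom.congr_fun (IsLocalization.ringHom_ext (.powers (var k A w i i))
      (j := f.toRingHom.comp g) (k := RingHom.id U) (by simpa using this)) z
  have : Algebra.Smooth A U := by
    have : Algebra.Etale A U := .of_equiv (AlgEquiv.ofAlgHom f g' h2 h1)
    infer_instance
  exact .comp k A U

include hX in
lemma smooth (hx : IsRegularParameters x) : Algebra.Smooth k (CoordRing k A w i) := by
  have : Algebra.FiniteType (MvPolynomial (Fin r) k) A := .of_restrictScalars_finiteType k _ _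
  have : Algebra.FiniteType k (CoordRing k A w i) :=
    .trans (S := WeightedPoly k w i) inferInstance inferInstance
  have : Algebra.FinitePresentation k (CoordRing k A w i) :=
    Algebra.FinitePresentation.of_finiteType.1 inferInstance
  refine ⟨Algebra.smoothLocus_eq_univ_iff.1 (Set.eq_univ_of_forall fun q => ?_), inferInstance⟩
  obtain ⟨c, hc, hs⟩ : ∃ c ∉ q.asIdeal, Algebra.Smooth k (Localization.Away c) := by
    by_cases hq : var k A w i i ∈ q.asIdeal
    · obtain ⟨g, hg, _⟩ := exists_smooth_away hX hx hq
      exact ⟨g, hg, .comp k (WeightedPoly k w i) _⟩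
    · exact ⟨_, hq, smooth_away_var hX⟩
  exact Algebra.basicOpen_subset_smoothLocus_iff_smooth.2 hs hc

include hX in
-- The ring is not yet known to be a domain. Near `u = 0` it is flat over the domain `k[u, x'_j]`,
-- so `u` is a nonzerodivisor; elsewhere `u` is invertible.
lemma eq_zero_of_var_mul (hx : IsRegularParameters x) {c : CoordRing k A w i}
    (hc : var k A w i i * c = 0) : c = 0 := by
  refine eq_zero_of_forall_prime c fun q hq => ?_
  by_cases h : var k A w i i ∈ q
  · obtain ⟨g, hg, _⟩ := exists_smooth_away hX hx h
    have : Module.Flat (WeightedPoly k w i) (Localization.Away g) := inferInstance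
    have := Module.Flat.isTorsionFree (R := WeightedPoly k w i) (M := Localization.Away g)
    have h0 : algebraMap (CoordRing k A w i) (Localization.Away g) c = 0 := by
      have h1 := congrArg (algebraMap (CoordRing k A w i) (Localization.Away g)) hc
      rw [map_zero, map_mul, var, ← IsScalarTower.algebraMap_apply, ← Algebra.smul_def] at h1
      exact (smul_eq_zero.1 h1).resolve_left (WeightedPoly.var_ne_zero i)
    obtain ⟨⟨_, n, rfl⟩, hn⟩ := (IsLocalization.map_eq_zero_iff (.powers g) _ _).1 h0
    exact ⟨g ^ n, fun h => hg (hq.mem_of_pow_mem _ h), hn⟩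
  · exact ⟨_, h, hc⟩

/-- If `c ↦ 0`, write `u^N c = F(u)` with `F` over `A`. Then `F(θ) = 0`, so `X^{w_i} - x_i` divides
`F`; it vanishes at `u`, whence `u^N c = 0`, and `u` is a nonzerodivisor. -/
lemma lift_injective (hx : IsRegularParameters x) {L : Type*} [CommRing L] [Algebra k L]
    [Algebra A L] [Algebra (MvPolynomial (Fin r) k) L] [IsScalarTower k (MvPolynomial (Fin r) k) L]
    [IsScalarTower (MvPolynomial (Fin r) k) A L]
    (θ : Lˣ) (hθ : (θ : L) ^ (w i : ℕ) = algebraMap A L (x i))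
    (H : ∀ F : A[X], Polynomial.aeval (θ : L) F = 0 → X ^ (w i : ℕ) - C (x i) ∣ F) :
    Function.Injective (lift hX θ hθ) := by
  rw [injective_iff_map_eq_zero]
  intro c hc
  obtain ⟨N, F, hF⟩ := exists_pow_mul_eq hX c
  have h0 : Polynomial.aeval (θ : L) F = 0 := by
    have := congrArg (lift hX θ hθ) hF
    rw [map_mul, hc, mul_zero] at this
    rw [this, Polynomial.aeval_def, ← AlgHom.coe_toRingHom, Polynomial.hom_eval₂]
    change _ = eval₂ _ (lift hX θ hθ (var k A w i i)) F
    rw [lift_var_self]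
    congr 1
    ext a
    exact (lift_incl hX θ hθ a).symm
  obtain ⟨G, rfl⟩ := H F h0
  have hroot : eval₂ (incl k w i).toRingHom (var k A w i i) (X ^ (w i : ℕ) - C (x i)) = 0 := by
    rw [eval₂_sub, eval₂_X_pow, eval₂_C, var_pow hX]
    exact sub_self _
  rw [eval₂_mul, hroot, zero_mul] at hF
  clear h0
  induction N with
  | zero => simpa using hF
  | succ n ih =>
    rw [pow_succ', mul_assoc] at hF
    exact ih (eq_zero_of_var_mul hX hx hF)

end CoordRing

/-! ### The ideals `I_{mγ}` -/

lemma val_pow {K : Type*} [Field K] (R : ValuationSubring K) (f : K) (n : ℕ) :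
    val R (f ^ n) = n • val R f := by
  induction n with
  | zero => rw [pow_zero, val_one, zero_nsmul]
  | succ n ih => rw [pow_succ, val_mul, ih, succ_nsmul]

section Ideals

variable {A : Type*} [CommRing A] [IsDomain A] {r : ℕ} {x : Fin r → A} {w : Fin r → ℕ+}

lemma memIdeal_zero (a : A) : MemIdeal x w 0 a := fun v => by
  rw [zero_nsmul]
  exact val_nonneg (v.2 a)

lemma MemIdeal.add {m : ℕ} {a b : A} (ha : MemIdeal x w m a) (hb : MemIdeal x w m b) :
    MemIdeal x w m (a + b) := fun v => by
  rw [ZariskiRiemann.eval, map_add]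
  exact le_val_add (ha v) (hb v)

lemma MemIdeal.mul {m n : ℕ} {a b : A} (ha : MemIdeal x w m a) (hb : MemIdeal x w n b) :
    MemIdeal x w (m + n) (a * b) := fun v => by
  rw [ZariskiRiemann.eval, map_mul, val_mul, add_nsmul]
  exact add_le_add (ha v) (hb v)

lemma MemIdeal.neg {m : ℕ} {a : A} (ha : MemIdeal x w m a) : MemIdeal x w m (-a) := by
  have := (memIdeal_zero (x := x) (w := w) (-1 : A)).mul ha
  rwa [zero_add, neg_one_mul] at this

lemma MemIdeal.sub {m : ℕ} {a b : A} (ha : MemIdeal x w m a) (hb : MemIdeal x w m b) :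
    MemIdeal x w m (a - b) := by
  rw [sub_eq_add_neg]
  exact ha.add hb.neg

lemma MemIdeal.of_le {m n : ℕ} (hmn : m ≤ n) {a : A} (ha : MemIdeal x w n a) :
    MemIdeal x w m a := fun v => by
  rcases le_total 0 (center x w v) with h | h
  · exact (nsmul_le_nsmul_left h hmn).trans (ha v)
  · exact (nsmul_nonpos h m).trans (val_nonneg (v.2 a))

lemma memIdeal_param (x : Fin r → A) (w : Fin r → ℕ+) (i : Fin r) : MemIdeal x w (w i) (x i) := by
  have := (y x w i).2 (w i)
  simpa [y] using this

/-- The homogeneous element `a T^m` of the Rees algebra. -/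
noncomputable def reesMonomial {m : ℕ} {a : A} (ha : MemIdeal x w m a) : reesAlg x w :=
  ⟨C a * X ^ m, fun n => by
    rw [coeff_C_mul_X_pow]
    split_ifs with h
    · rwa [h]
    · simpa using ((memIdeal_zero (x := x) (w := w) (0 : A)).mul
        (fun v => by simp [ZariskiRiemann.eval, val_zero] : MemIdeal x w n (0 : A)))⟩

/-- A multiple of `y_i - 1` in `A[T]` which lies in the Rees algebra is a multiple there. -/
lemma mem_reesAlg_of_mul_mem {i : Fin r} {G : A[X]}
    (h : (C (x i) * X ^ (w i : ℕ) - 1) * G ∈ reesAlg x w) : G ∈ reesAlg x w := by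
  intro n
  induction n using Nat.strong_induction_on with
  | _ n ih =>
    have h1 := h n
    have h2 : ((C (x i) * X ^ (w i : ℕ) - 1) * G).coeff n =
        x i * (if (w i : ℕ) ≤ n then G.coeff (n - w i) else 0) - G.coeff n := by
      rw [sub_mul, one_mul, coeff_sub, mul_assoc, coeff_C_mul, coeff_X_pow_mul']
    have h3 : G.coeff n = x i * (if (w i : ℕ) ≤ n then G.coeff (n - w i) else 0) -
        ((C (x i) * X ^ (w i : ℕ) - 1) * G).coeff n := by
      rw [h2, sub_sub_cancel]
    rw [h3]
    -- Induction on the recursion `G_n = x_i G_{n - w_i} - (product)_n`, using `x_i ∈ I_{w_i γ}`.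
    refine MemIdeal.sub ?_ h1
    split_ifs with hn
    · have := (memIdeal_param x w i).mul (ih (n - w i) (Nat.sub_lt_self (w i).pos hn))
      rwa [Nat.add_sub_cancel' hn] at this
    · rw [mul_zero]
      intro v
      simp [ZariskiRiemann.eval, val_zero]

/-- The valuative meaning of `f ∈ I_{mγ}`, on an extension of the function field in which the
parameters have a common weighted divisor `θ`. -/
lemma MemIdeal.div_pow_mem {L : Type*} [Field L] [Algebra A L] [Algebra (FractionRing A) L]
    [IsScalarTower A (FractionRing A) L] (hr : 0 < r) {m : ℕ} {f : A} (hf : MemIdeal x w m f)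
    (V : ValuationSubring L) (hV : ∀ a, algebraMap A L a ∈ V)
    {θ : L} (hθ : θ ≠ 0) (t : Fin r → V) (ht : ∀ j, algebraMap A L (x j) = t j * θ ^ (w j : ℕ)) :
    algebraMap A L f / θ ^ m ∈ V := by
  let v : ZariskiRiemann A := ⟨V.comap (algebraMap (FractionRing A) L), fun a => by
    rw [ValuationSubring.mem_comap, ← IsScalarTower.algebraMap_apply]
    exact hV a⟩
  have : Nonempty (Fin r) := ⟨⟨0, hr⟩⟩
  obtain ⟨j, -, hj⟩ := Finset.exists_mem_eq_inf Finset.univ Finset.univ_nonempty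
    fun i => ratMul (1 / ((w i : ℕ) : ℚ)) (v.eval (x i))
  have h1 := hf v
  rw [center, hj] at h1
  -- The minimum `γ_v` is attained at `j`. Multiplying by `w_j` clears the denominator: `w_j v(f) ≥
  -- m v(x_j)`, so `x_j^m` divides `f^{w_j}` in the valuation ring.
  have h2 := nsmul_le_nsmul_right h1 (w j : ℕ)
  rw [nsmul_left_comm, nsmul_ratMul, ZariskiRiemann.eval, ZariskiRiemann.eval, ← val_pow, ← val_pow,
    val_le_val, ValuationSubring.valuation_le_iff] at h2
  obtain ⟨⟨s, hs⟩, hsf⟩ := h2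
  rw [ValuationSubring.mem_comap] at hs
  have h3 : algebraMap A L f ^ (w j : ℕ) =
      algebraMap (FractionRing A) L s * algebraMap A L (x j) ^ m := by
    have := congrArg (algebraMap (FractionRing A) L) hsf
    rw [map_mul, map_pow, map_pow, ← IsScalarTower.algebraMap_apply,
      ← IsScalarTower.algebraMap_apply] at this
    exact this.symm
  have h4 : (algebraMap A L f / θ ^ m) ^ (w j : ℕ) = algebraMap (FractionRing A) L s * t j ^ m := by
    rw [div_pow, div_eq_iff (pow_ne_zero _ (pow_ne_zero _ hθ)), h3, ht]
    ring
  have h5 : (algebraMap A L f / θ ^ m) ^ (w j : ℕ) ∈ V := by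
    rw [h4]
    exact mul_mem hs (pow_mem (t j).2 m)
  rw [← ValuationSubring.valuation_le_one_iff, map_pow] at h5
  rw [← ValuationSubring.valuation_le_one_iff]
  -- Only the `w_j`-th power of `f/θ^m` was shown to lie in `V`; valuation rings are closed under
  -- roots.
  exact (pow_le_one_iff (w j).ne_zero).1 h5

end Ideals

/-! ### The chart ring inside a field -/

section ChartRing

variable {A : Type*} [CommRing A] [IsDomain A] {r : ℕ} (x : Fin r → A) (w : Fin r → ℕ+) (i : Fin r)

/-- The canonical map from the Rees algebra to the chart ring. -/
noncomputable def toChartRing : reesAlg x w →+* ChartRing x w i :=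
  (Ideal.Quotient.mk _).comp (algebraMap (reesAlg x w) (Localization.Away (y x w i)))

lemma toChartRing_y : toChartRing x w i (y x w i) = 1 := by
  rw [← sub_eq_zero, ← map_one (Ideal.Quotient.mk _)]
  exact Ideal.Quotient.eq_zero_iff_mem.2 (Ideal.subset_span rfl)

/-- Denominators are powers of `y_i`, which becomes `1`. -/
lemma toChartRing_surjective : Function.Surjective (toChartRing x w i) := by
  intro b
  obtain ⟨z, rfl⟩ := Ideal.Quotient.mk_surjective b
  obtain ⟨⟨F, _, n, rfl⟩, h⟩ := IsLocalization.surj (.powers (y x w i)) z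
  refine ⟨F, ?_⟩
  have := congrArg (Ideal.Quotient.mk (Ideal.span
    {algebraMap (reesAlg x w) (Localization.Away (y x w i)) (y x w i) - 1})) h
  rw [map_mul, map_pow, map_pow] at this
  change _ * toChartRing x w i (y x w i) ^ n = toChartRing x w i F at this
  rw [toChartRing_y, one_pow, mul_one] at this
  exact this.symm

variable {x w i} {L : Type*} [Field L] [Algebra A L] (θ : L)
  (hθ : θ ^ (w i : ℕ) = algebraMap A L (x i)) (hθ0 : θ ≠ 0)

include hθ hθ0 in
lemma aeval_inv_y : (Polynomial.aeval θ⁻¹ : A[X] →ₐ[A] L) (y x w i) = 1 := by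
  simp only [y, map_mul, map_pow, aeval_X, aeval_C]
  rw [← hθ, ← mul_pow, mul_inv_cancel₀ hθ0, one_pow]

include hθ hθ0 in
lemma isUnit_aeval_inv_y : IsUnit (((Polynomial.aeval θ⁻¹ : A[X] →ₐ[A] L).toRingHom.comp
    (reesAlg x w).val.toRingHom) (y x w i)) := by
  change IsUnit ((Polynomial.aeval θ⁻¹ : A[X] →ₐ[A] L) (y x w i))
  rw [aeval_inv_y θ hθ hθ0]
  exact isUnit_one

/-- The map from the chart ring given by a `w_i`-th root `θ` of `x_i`, sending `T` to `θ⁻¹`. -/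
noncomputable def chartLift : ChartRing x w i →+* L :=
  Ideal.Quotient.lift _ (IsLocalization.Away.lift (y x w i) (isUnit_aeval_inv_y θ hθ hθ0)) (by
    intro a ha
    rw [← RingHom.mem_ker]
    refine (Ideal.span_le (I := RingHom.ker _)).2 ?_ ha
    rw [Set.singleton_subset_iff, SetLike.mem_coe, RingHom.mem_ker, map_sub,
      IsLocalization.Away.lift_eq, map_one, sub_eq_zero]
    exact aeval_inv_y θ hθ hθ0)

lemma chartLift_toChartRing (F : reesAlg x w) :
    chartLift θ hθ hθ0 (toChartRing x w i F) = (Polynomial.aeval θ⁻¹ : A[X] →ₐ[A] L) F :=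
  IsLocalization.Away.lift_eq (y x w i) (isUnit_aeval_inv_y θ hθ hθ0) F

include hθ0 in
/-- Reversal turns divisibility by `T^n - a` into divisibility by `a T^n - 1`. -/
lemma exists_eq_mul_of_aeval_inv {n : ℕ} (hn : 0 < n) {a : A}
    (H : ∀ F : A[X], Polynomial.aeval θ F = 0 → X ^ n - C a ∣ F) {F : A[X]}
    (hF : Polynomial.aeval θ⁻¹ F = 0) : ∃ G, F = (C a * X ^ n - 1) * G := by
  let := invertibleOfNonzero (inv_ne_zero hθ0)
  obtain ⟨N, hN⟩ : ∃ N, F.natDegree = N := ⟨_, rfl⟩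
  have h1 : Polynomial.aeval θ (reflect N F) = 0 := by
    have := (eval₂_reflect_eq_zero_iff (algebraMap A L) θ⁻¹ N F hN.le).2 hF
    rwa [invOf_eq_inv, inv_inv] at this
  obtain ⟨Q, hQ⟩ := H _ h1
  by_cases hQ0 : Q = 0
  · rw [hQ0, mul_zero, reflect_eq_zero_iff] at hQ
    exact ⟨0, by rw [hQ, mul_zero]⟩
  have hmonic : (X ^ n - C a : A[X]).Monic := monic_X_pow_sub_C _ hn.ne'
  have hdeg : n + Q.natDegree ≤ N := by
    have h2 := natDegree_reflect_le (N := N) (p := F)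
    rwa [hQ, hmonic.natDegree_mul' hQ0, natDegree_X_pow_sub_C, hN, max_self] at h2
  -- The reversal of `X^n - a` is `1 - a X^n`, whence the sign.
  refine ⟨-reflect (N - n) Q, ?_⟩
  have h3 := congrArg (reflect N) hQ
  rw [reflect_reflect] at h3
  rw [h3]
  conv_lhs => rw [← Nat.add_sub_cancel' (le_trans (Nat.le_add_right _ _) hdeg)]
  rw [reflect_mul _ _ (by rw [natDegree_X_pow_sub_C]) (by omega), reflect_sub, reflect_monomial,
    reflect_C, revAt_le le_rfl, Nat.sub_self, pow_zero]
  ring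

include hθ0 in
/-- Each quotient of the Rees algebra in which `y_i = 1` and which maps to `L` is embedded there. -/
lemma injective_of_comp_eq_aeval_inv
    (H : ∀ F : A[X], Polynomial.aeval θ F = 0 → X ^ (w i : ℕ) - C (x i) ∣ F)
    {B : Type*} [CommRing B] {σ : reesAlg x w →+* B} (hσ : Function.Surjective σ)
    (hy : σ (y x w i) = 1) {ψ : B →+* L}
    (hψ : ∀ F, ψ (σ F) = (Polynomial.aeval θ⁻¹ : A[X] →ₐ[A] L) F) : Function.Injective ψ := by
  rw [injective_iff_map_eq_zero]
  intro b hb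
  obtain ⟨F, rfl⟩ := hσ b
  rw [hψ] at hb
  obtain ⟨G, hG⟩ := exists_eq_mul_of_aeval_inv θ hθ0 (w i).pos H hb
  have hG' : G ∈ reesAlg x w := mem_reesAlg_of_mul_mem (hG ▸ F.2)
  have : F = (y x w i - 1) * ⟨G, hG'⟩ := Subtype.ext hG
  rw [this, map_mul, map_sub, hy, map_one, sub_self, zero_mul]

end ChartRing

/-! ### Equality of the images of the coordinate ring and of the chart ring in `L`. -/

namespace CoordRing

variable {k A : Type u} [Field k] [CommRing A] [Algebra k A]
  {r : ℕ} [Algebra (MvPolynomial (Fin r) k) A] [IsScalarTower k (MvPolynomial (Fin r) k) A]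
  {w : Fin r → ℕ+} {i : Fin r}

lemma mem_of_mem {S : Subring (CoordRing k A w i)} (h : ∀ a, incl k w i a ∈ S)
    (h' : ∀ j, var k A w i j ∈ S) (c : CoordRing k A w i) : c ∈ S := by
  induction c using TensorProduct.induction_on with
  | zero => exact zero_mem S
  | add a b ha hb => exact add_mem ha hb
  | tmul p a =>
    have hp : p ⊗ₜ[MvPolynomial (Fin r) k] a = algebraMap (WeightedPoly k w i) _ p * incl k w i a := by
      simp [incl]
    rw [hp]
    refine mul_mem ?_ (h a)
    clear hp
    induction p using WeightedPoly.induction_on with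
    | algebraMap a =>
      rw [← IsScalarTower.algebraMap_apply k, algebraMap_eq]
      exact h _
    | add p q hp hq =>
      rw [map_add]
      exact add_mem hp hq
    | mul_var p j hp =>
      rw [map_mul]
      exact mul_mem hp (h' j)

end CoordRing

section Comparison

variable {k A : Type u} [Field k] [CommRing A] [IsDomain A] [Algebra k A]
  {r : ℕ} [Algebra (MvPolynomial (Fin r) k) A] [IsScalarTower k (MvPolynomial (Fin r) k) A]
  {w : Fin r → ℕ+} {i : Fin r}
  {x : Fin r → A} (hX : ∀ j, algebraMap (MvPolynomial (Fin r) k) A (.X j) = x j)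
  {L : Type u} [Field L] [Algebra k L]
  [Algebra A L] [Algebra (MvPolynomial (Fin r) k) L] [IsScalarTower k (MvPolynomial (Fin r) k) L]
  [IsScalarTower (MvPolynomial (Fin r) k) A L]
  (θ : Lˣ) (hθ : (θ : L) ^ (w i : ℕ) = algebraMap A L (x i))

lemma lift_mem_range (c : CoordRing k A w i) :
    ∃ F : reesAlg x w, (Polynomial.aeval (θ : L)⁻¹ : A[X] →ₐ[A] L) F = CoordRing.lift hX θ hθ c := by
  let ψ : reesAlg x w →+* L := (Polynomial.aeval (θ : L)⁻¹ : A[X] →ₐ[A] L).toRingHom.comp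
    (reesAlg x w).val.toRingHom
  refine CoordRing.mem_of_mem (S := ψ.range.comap (CoordRing.lift hX θ hθ).toRingHom)
    (fun a => ?_) (fun j => ?_) c
  · refine ⟨algebraMap A _ a, ?_⟩
    change (Polynomial.aeval (θ : L)⁻¹ : A[X] →ₐ[A] L) (C a) = CoordRing.lift hX θ hθ _
    rw [aeval_C, CoordRing.lift_incl]
  · by_cases hj : j = i
    · subst hj
      -- The element `x_i T^{w_i - 1}` lies in the Rees algebra because the ideals `I_{mγ}` decrease
      -- with `m`; at `T = θ⁻¹` it gives `θ^{w_i} / θ^{w_i - 1} = θ`.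
      refine ⟨reesMonomial ((memIdeal_param x w j).of_le (Nat.sub_le _ 1)), ?_⟩
      change (Polynomial.aeval (θ : L)⁻¹ : A[X] →ₐ[A] L) (C (x j) * X ^ ((w j : ℕ) - 1)) =
        CoordRing.lift hX θ hθ _
      rw [CoordRing.lift_var_self, map_mul, map_pow, aeval_C, aeval_X, ← hθ]
      conv_lhs => rw [← Nat.sub_add_cancel (w j).pos, Nat.add_sub_cancel, pow_succ]
      rw [mul_right_comm, ← mul_pow, mul_inv_cancel₀ θ.ne_zero, one_pow, one_mul]
    · refine ⟨reesMonomial (memIdeal_param x w j), ?_⟩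
      change (Polynomial.aeval (θ : L)⁻¹ : A[X] →ₐ[A] L) (C (x j) * X ^ (w j : ℕ)) =
        CoordRing.lift hX θ hθ _
      rw [CoordRing.lift_var hX θ hθ hj, map_mul, map_pow, aeval_C, aeval_X]
      simp

variable [CharZero k] [Algebra.Smooth k A] [Algebra (FractionRing A) L] [IsScalarTower A (FractionRing A) L]

/-- This is where the valuative definition of `I_{mγ}` enters. The integral closure of `R` in `L` is
the intersection of the valuation rings containing it, and in each of them `θ^{w_j}` divides `x_j`
for all `j`, so `v(f) ≥ m γ_v ≥ m v(θ)`. -/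
lemma div_pow_mem_range (hx : IsRegularParameters x)
    (H : ∀ F : A[X], Polynomial.aeval (θ : L) F = 0 → X ^ (w i : ℕ) - C (x i) ∣ F)
    {m : ℕ} {f : A} (hf : MemIdeal x w m f) :
    algebraMap A L f / (θ : L) ^ m ∈ (CoordRing.lift hX θ hθ).toRingHom.range := by
  let R := CoordRing k A w i
  let φ := CoordRing.lift hX θ hθ
  have hφ : Function.Injective φ := CoordRing.lift_injective hX hx θ hθ H
  have : IsDomain R := hφ.isDomain φ.toRingHom
  have : Algebra.Smooth k R := CoordRing.smooth hX hx
  have : IsIntegrallyClosed R := isIntegrallyClosed_of_smooth k R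
  let : Algebra R L := φ.toRingHom.toAlgebra
  have hint : IsIntegral R (algebraMap A L f / (θ : L) ^ m) := by
    by_contra hz
    obtain ⟨V, hV, hzV⟩ := Subring.exists_le_valuationSubring_of_isIntegrallyClosedIn
      (R := (integralClosure R L).toSubring) hz
    have hmem : ∀ c : R, φ c ∈ V := fun c => hV (isIntegral_algebraMap (R := R) (x := c))
    refine hzV (hf.div_pow_mem hx.pos V (fun a => ?_) θ.ne_zero
      (fun j => if j = i then 1 else ⟨_, hmem (CoordRing.var k A w i j)⟩) fun j => ?_)
    · have := hmem (CoordRing.incl k w i a)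
      rwa [CoordRing.lift_incl] at this
    · by_cases hj : j = i
      · subst hj
        simp [hθ]
      · simp only [if_neg hj, φ, CoordRing.lift_var hX θ hθ hj]
        rw [mul_assoc, inv_pow, ← Units.val_pow_eq_pow_val, Units.inv_mul, mul_one]
  -- Normality of `R` concerns only elements of `Frac R`, so `f/θ^m` is written as the image of
  -- `f/u^m`.
  let ι : FractionRing R →ₐ[R] L := IsFractionRing.liftAlgHom (K := FractionRing R)
    (g := Algebra.ofId R L) hφ
  have hu : CoordRing.var k A w i i ≠ 0 := fun h => θ.ne_zero (by
    rw [← CoordRing.lift_var_self hX θ hθ, h, map_zero])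
  have hz : algebraMap A L f / (θ : L) ^ m = ι (algebraMap R (FractionRing R) (CoordRing.incl k w i f) /
      algebraMap R (FractionRing R) (CoordRing.var k A w i i) ^ m) := by
    rw [map_div₀, map_pow, ι.commutes, ι.commutes]
    change _ = φ _ / φ _ ^ m
    rw [CoordRing.lift_incl, CoordRing.lift_var_self]
  rw [hz] at hint ⊢
  obtain ⟨c, hc⟩ := IsIntegrallyClosed.isIntegral_iff.1
    ((isIntegral_algHom_iff ι ι.toRingHom.injective).1 hint)
  refine ⟨c, ?_⟩
  rw [← hc, ι.commutes]
  rfl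

lemma aeval_mem_range (hx : IsRegularParameters x)
    (H : ∀ F : A[X], Polynomial.aeval (θ : L) F = 0 → X ^ (w i : ℕ) - C (x i) ∣ F)
    (F : reesAlg x w) : (Polynomial.aeval (θ : L)⁻¹ : A[X] →ₐ[A] L) F ∈
      (CoordRing.lift hX θ hθ).toRingHom.range := by
  rw [Polynomial.aeval_eq_sum_range]
  refine sum_mem fun m _ => ?_
  rw [Algebra.smul_def, inv_pow, ← div_eq_mul_inv]
  exact div_pow_mem_range hX θ hθ hx H (F.2 m)

end Comparison

/-! ### Conclusion over `L = K(x_i^{1/w_i})`. -/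

/-- Divisibility by a monic polynomial descends from `K[X]` to `A[X]`. -/
lemma dvd_of_aeval_root_eq_zero {A : Type*} [CommRing A] {n : ℕ} (hn : 0 < n) {a : A} {F : A[X]}
    (hF : Polynomial.aeval (AdjoinRoot.root ((X ^ n - C a : A[X]).map
      (algebraMap A (FractionRing A)))) F = 0) : X ^ n - C a ∣ F := by
  rw [← Polynomial.map_dvd_map (algebraMap A (FractionRing A)) (IsFractionRing.injective _ _)
    (monic_X_pow_sub_C _ hn.ne'), ← AdjoinRoot.mk_eq_zero, ← AdjoinRoot.aeval_eq,
    Polynomial.aeval_map_algebraMap]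
  exact hF

lemma nonempty_algEquiv_of_range_eq {k R B L : Type*} [CommRing k] [CommRing R] [CommRing B]
    [CommRing L] [Algebra k R] [Algebra k B] {φ : R →+* L} {ψ : B →+* L}
    (hφ : Function.Injective φ) (hψ : Function.Injective ψ) (h : φ.range = ψ.range)
    (hk : ∀ a, φ (algebraMap k R a) = ψ (algebraMap k B a)) : Nonempty (R ≃ₐ[k] B) := by
  let e := ((RingEquiv.ofBijective φ.rangeRestrict
    ⟨fun a b hab => hφ (congrArg Subtype.val hab), φ.rangeRestrict_surjective⟩).trans
      (RingEquiv.subringCongr h)).trans (RingEquiv.ofBijective ψ.rangeRestrict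
    ⟨fun a b hab => hψ (congrArg Subtype.val hab), ψ.rangeRestrict_surjective⟩).symm
  refine ⟨AlgEquiv.ofRingEquiv (f := e) fun a => ?_⟩
  rw [RingEquiv.trans_apply, RingEquiv.symm_apply_eq]
  exact Subtype.ext (hk a)

/-- Each quotient of the Rees algebra in which `y_i = 1` and which maps to an extension of the
function field containing a root of `x_i` is smooth, of the dimension of `A`. -/
lemma isDomain_and_smooth_of_comp_eq_aeval_inv {k A B L : Type u} [Field k] [CharZero k]
    [CommRing A] [IsDomain A] [Algebra k A] [Algebra.Smooth k A] [CommRing B] [Algebra k B]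
    {r : ℕ} [Algebra (MvPolynomial (Fin r) k) A] [IsScalarTower k (MvPolynomial (Fin r) k) A]
    {x : Fin r → A} (hX : ∀ j, algebraMap (MvPolynomial (Fin r) k) A (.X j) = x j)
    (hx : IsRegularParameters x) {w : Fin r → ℕ+} {i : Fin r}
    [Field L] [Algebra k L] [Algebra A L] [Algebra (MvPolynomial (Fin r) k) L]
    [IsScalarTower k (MvPolynomial (Fin r) k) L] [IsScalarTower (MvPolynomial (Fin r) k) A L]
    [Algebra (FractionRing A) L] [IsScalarTower A (FractionRing A) L] [IsScalarTower k A L]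
    [FaithfulSMul A L] [Algebra.IsAlgebraic A L]
    (θ : Lˣ) (hθ : (θ : L) ^ (w i : ℕ) = algebraMap A L (x i))
    (H : ∀ F : A[X], Polynomial.aeval (θ : L) F = 0 → X ^ (w i : ℕ) - C (x i) ∣ F)
    {σ : reesAlg x w →+* B} (hσ : Function.Surjective σ) (hy : σ (y x w i) = 1)
    (hk : ∀ a, σ (algebraMap A _ (algebraMap k A a)) = algebraMap k B a) {ψ : B →+* L}
    (hψ : ∀ F, ψ (σ F) = (Polynomial.aeval (θ : L)⁻¹ : A[X] →ₐ[A] L) F) :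
    IsDomain B ∧ Algebra.Smooth k B ∧ ringKrullDim B = ringKrullDim A := by
  have hψA (a : A) : ψ (σ (algebraMap A _ a)) = algebraMap A L a := by
    rw [hψ]
    exact aeval_C _ _
  have hψi : Function.Injective ψ := injective_of_comp_eq_aeval_inv θ.1 θ.ne_zero H hσ hy hψ
  have : IsDomain B := hψi.isDomain ψ
  obtain ⟨e⟩ : Nonempty (CoordRing k A w i ≃ₐ[k] B) := by
    refine nonempty_algEquiv_of_range_eq (φ := (CoordRing.lift hX θ hθ).toRingHom)
      (CoordRing.lift_injective hX hx θ hθ H) hψi (le_antisymm ?_ ?_) fun a => ?_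
    · rintro _ ⟨c, rfl⟩
      obtain ⟨F, hF⟩ := lift_mem_range hX θ hθ c
      exact ⟨σ F, (hψ F).trans hF⟩
    · rintro _ ⟨b, rfl⟩
      obtain ⟨F, rfl⟩ := hσ b
      rw [hψ]
      exact aeval_mem_range hX θ hθ hx H F
    · rw [← hk, hψA, CoordRing.algebraMap_eq]
      exact CoordRing.lift_incl hX θ hθ _
  have := CoordRing.smooth (w := w) (i := i) hX hx
  have : Algebra.Smooth k B := .of_equiv e
  refine ⟨inferInstance, inferInstance, ?_⟩
  let : Algebra B L := ψ.toAlgebra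
  let : Algebra A B := (σ.comp (algebraMap A _)).toAlgebra
  have : IsScalarTower A B L := .of_algebraMap_eq fun a => (hψA a).symm
  have : IsScalarTower k B L := .of_algebraMap_eq fun a => by
    rw [← hk, IsScalarTower.algebraMap_apply k A L]
    exact (hψA _).symm
  have : FaithfulSMul B L := (faithfulSMul_iff_algebraMap_injective B L).2 hψi
  -- `A` embeds in `B`, since it embeds in `L`; so `L`, algebraic over `A`, is algebraic over `B`.
  have : Algebra.IsAlgebraic B L := .extendScalars (R := A) <| .of_comp (f := algebraMap B L) <| by
    rw [← RingHom.coe_comp, ← IsScalarTower.algebraMap_eq]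
    exact FaithfulSMul.algebraMap_injective A L
  exact ringKrullDim_eq_of_isAlgebraic (k := k) (L := L)

/-- The chart is irreducible and smooth, of the dimension of `A`. -/
lemma chartRing_isDomain_and_smooth (k A : Type u) [Field k] [CharZero k] [CommRing A] [IsDomain A]
    [Algebra k A] [Algebra.Smooth k A] {r : ℕ} (x : Fin r → A) (hx : IsRegularParameters x)
    (w : Fin r → ℕ+) (i : Fin r) :
    IsDomain (ChartRing x w i) ∧ Algebra.Smooth k (ChartRing x w i) ∧
      ringKrullDim (ChartRing x w i) = ringKrullDim A := by
  let : Algebra (MvPolynomial (Fin r) k) A := (MvPolynomial.aeval x).toRingHom.toAlgebra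
  have : IsScalarTower k (MvPolynomial (Fin r) k) A :=
    .of_algebraMap_eq' (MvPolynomial.aeval x).comp_algebraMap.symm
  have hX : ∀ j, algebraMap (MvPolynomial (Fin r) k) A (.X j) = x j := MvPolynomial.aeval_X x
  let f := (X ^ (w i : ℕ) - C (x i) : A[X]).map (algebraMap A (FractionRing A))
  have : Fact (Irreducible f) := ⟨hx.irreducible k i (w i).pos⟩
  let L := AdjoinRoot f
  have hroot : (AdjoinRoot.root f : L) ^ (w i : ℕ) = algebraMap A L (x i) := by
    have h := AdjoinRoot.eval₂_root f
    rw [eval₂_map, eval₂_sub, eval₂_X_pow, eval₂_C, sub_eq_zero] at h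
    exact h
  have : FaithfulSMul A L := (faithfulSMul_iff_algebraMap_injective A L).2 (by
    rw [IsScalarTower.algebraMap_eq A (FractionRing A) L]
    exact (algebraMap (FractionRing A) L).injective.comp (IsFractionRing.injective _ _))
  have hroot0 : AdjoinRoot.root f ≠ 0 := fun h => by
    rw [h, zero_pow (w i).ne_zero, eq_comm, FaithfulSMul.algebraMap_eq_zero_iff] at hroot
    exact hx.ne_zero k i hroot
  have H : ∀ F : A[X], Polynomial.aeval (AdjoinRoot.root f) F = 0 → X ^ (w i : ℕ) - C (x i) ∣ F :=
    fun F hF => dvd_of_aeval_root_eq_zero (w i).pos hF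
  let θ : Lˣ := Units.mk0 _ hroot0
  have : Algebra.IsAlgebraic (FractionRing A) L :=
    have := (AdjoinRoot.powerBasis (Fact.out : Irreducible f).ne_zero).finite
    inferInstance
  have : Algebra.IsAlgebraic A L := (IsFractionRing.comap_isAlgebraic_iff (K := FractionRing A)).2 this
  exact isDomain_and_smooth_of_comp_eq_aeval_inv hX hx θ hroot H (toChartRing_surjective x w i)
    (toChartRing_y x w i) (fun a => rfl) (chartLift_toChartRing _ hroot hroot0)

end WeightedBlowup

theorem mainTheorem4 (k A : Type u) [Field k] [CharZero k] [CommRing A] [IsDomain A] [Algebra k A]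
    (hY : WeightedBlowup.IsSmoothVariety (WeightedBlowup.structureMap k A))
    {r : ℕ} (x : Fin r → A) (hx : WeightedBlowup.IsRegularParameters x)
    (w : Fin r → ℕ+) (i : Fin r) :
    IrreducibleSpace (WeightedBlowup.chart x w i) ∧
      WeightedBlowup.IsSmoothVariety (WeightedBlowup.chartMap k x w i) ∧
      topologicalKrullDim (WeightedBlowup.chart x w i) =
        topologicalKrullDim (Spec (CommRingCat.of A)) := by
  have : Algebra.Smooth k A := RingHom.smooth_algebraMap.1
    ((HasRingHomProperty.Spec_iff (P := @Smooth)).1 hY.smooth)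
  obtain ⟨hdom, hsm, hdim⟩ := WeightedBlowup.chartRing_isDomain_and_smooth k A x hx w i
  have hs : Smooth (WeightedBlowup.chartMap k x w i) :=
    (HasRingHomProperty.Spec_iff (P := @Smooth)).2 (RingHom.smooth_algebraMap.2 hsm)
  refine ⟨?_, ⟨?_, ?_, hs⟩, ?_⟩
  · exact inferInstanceAs (IrreducibleSpace (PrimeSpectrum (WeightedBlowup.ChartRing x w i)))
  · infer_instance
  · exact inferInstanceAs (QuasiCompact (Spec.map _))
  · exact (PrimeSpectrum.topologicalKrullDim_eq_ringKrullDim _).trans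
      (hdim.trans (PrimeSpectrum.topologicalKrullDim_eq_ringKrullDim A).symm)
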